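/- Let $\mathbb D$ be the open unit disc of $\mathbb C$ and $dA$ the normalized area measure on it. A radial weight is a positive integrable function $\omega$ on $[0,1)$, extended to $\mathbb D$ by $\omega(z)=\omega(|z|)$; it is called regular if there are constants $0<c\le C<\infty$ such that $$c\le\frac{\int_r^1\omega(t)\,dt}{(1-r)\,\omega(r)}\le C\qquad\text{for all } r\in[0,1).$$ For $0<p<\infty$, the weighted Bergman space $A^p_\omega$ consists of all analytic functions $f$ on $\mathbb D$ with $\|f\|_{A^p_\omega}=\left(\int_{\mathbb D}|f|^p\,\omega\,dA\right)^{1/p}<\infty$. For a positive Borel measure $\mu$ on $\mathbb D$ and $0<s<\infty$, write $\|f\|_{L^s_\mu}=\left(\int_{\mathbb D}|f|^s\,d\mu\right)^{1/s}$; $\mu$ is called an $s$-Carleson measure for $A^p_\omega$ if the identity operator $I_d:A^p_\omega\to L^s_\mu$ is bounded, and $\|I_d\|_{A^p_\omega\to L^s_\mu}=\sup_{0\ne f\in A^p_\omega}\|f\|_{L^s_\mu}/\|f\|_{A^p_\omega}\in[0,\infty]$. **Theorem 2.** Let $n\ge1$, let $0<p_i,q_i<\infty$ and let $\omega_i$ be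 regular weights, $i=1,\dots,n$. Put $$\lambda=\sum_{i=1}^n\frac{q_i}{p_i},\qquad \omega(z)=\prod_{i=1}^n\omega_i(z)^{\frac{q_i}{\lambda p_i}},$$ and, for a positive Borel measure $\mu$ on $\mathbb D$, $$M_n(\mu)=\sup_{0\ne f_i\in A^{p_i}_{\omega_i},\ i=1,\dots,n}\ \frac{\int_{\mathbb D}\prod_{i=1}^n|f_i(z)|^{q_i}\,d\mu(z)}{\prod_{i=1}^n\|f_i\|_{A^{p_i}_{\omega_i}}^{q_i}}\in[0,\infty].$$ Then, for every positive Borel measure $\mu$ on $\mathbb D$, $\mu$ is a $\lambda$-Carleson measure for $A^1_\omega$ if and only if $M_n(\mu)<\infty$. Moreover, there is a constant $0<C<\infty$, depending only on $n$ and the $p_i,q_i,\omega_i$ (and not on $\mu$), such that for every positive Borel measure $\mu$ on $\mathbb D$ $$C^{-1}\,\|I_d\|_{A^{1/\lambda}_\omega\to L^1_\mu}\le M_n(\mu)\le C\,\|I_d\|_{A^{1/\lambda}_\omega\to L^1_\mu}.$$ -/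

import Mathlib

open MeasureTheory
open scoped ENNReal NNReal

noncomputable section

namespace WeightedBergman

/-- The open unit disc of the complex plane. -/
def disc : Set ℂ := Metric.ball 0 1

/-- The normalized area measure `dA` on the unit disc. -/
def areaMeasure : Measure ℂ := ENNReal.ofReal (Real.pi)⁻¹ • volume.restrict disc

/-- The tail integral `∫_r^1 ω(t) dt`. -/
def tail (ω : ℝ → ℝ) (r : ℝ) : ℝ := ∫ t in r..1, ω t

/-- A radial weight is given by its profile on `[0,1)`, a positive integrable function; the weight
itself is `z ↦ ω ‖z‖` on the disc. Values of the profile outside `[0,1)` play no role.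
(Lebesgue measurability is part of `IntegrableOn`.) -/
structure IsRadialWeight (ω : ℝ → ℝ) : Prop where
  pos : ∀ r ∈ Set.Ico (0 : ℝ) 1, 0 < ω r
  integrable : IntegrableOn ω (Set.Ico (0 : ℝ) 1) volume

/-- Regular weights: `tail ω r / ((1 - r) ω r)` is bounded above and below by positive constants
on `[0,1)`. -/
structure IsRegularWeight (ω : ℝ → ℝ) : Prop extends IsRadialWeight ω where
  comparable : ∃ c C : ℝ, 0 < c ∧ ∀ r ∈ Set.Ico (0 : ℝ) 1,
    c ≤ tail ω r / ((1 - r) * ω r) ∧ tail ω r / ((1 - r) * ω r) ≤ C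

/-- The measure `ω dA` on the unit disc. -/
def weightMeasure (ω : ℝ → ℝ) : Measure ℂ :=
  areaMeasure.withDensity fun z => ENNReal.ofReal (ω ‖z‖)

/-- The `L^p_μ` (quasi-)norm on the disc, `(∫_𝔻 |f|^p dμ)^{1/p}`, for `0 < p < ∞`. -/
def lpNorm (p : ℝ) (μ : Measure ℂ) (f : ℂ → ℂ) : ℝ≥0∞ :=
  eLpNorm f (ENNReal.ofReal p) (μ.restrict disc)

/-- The (quasi-)norm of the weighted Bergman space `A^p_ω`. -/
def bergmanNorm (p : ℝ) (ω : ℝ → ℝ) (f : ℂ → ℂ) : ℝ≥0∞ := lpNorm p (weightMeasure ω) f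

/-- The weighted Bergman space `A^p_ω`: functions analytic in the disc with finite norm. -/
def bergmanSpace (p : ℝ) (ω : ℝ → ℝ) : Set (ℂ → ℂ) :=
  {f | DifferentiableOn ℂ f disc ∧ bergmanNorm p ω f < ∞}

/-- `μ` is a `q`-Carleson measure for `A^p_ω`: the identity `A^p_ω → L^q_μ` is bounded. -/
def IsCarleson (q : ℝ) (p : ℝ) (ω : ℝ → ℝ) (μ : Measure ℂ) : Prop :=
  ∃ C : ℝ≥0, ∀ f ∈ bergmanSpace p ω, lpNorm q μ f ≤ C * bergmanNorm p ω f

/-- The operator norm of the identity `A^p_ω → L^q_μ`, with value `∞` if it is unbounded.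
For `f = 0` the quotient is `0 / 0 = 0`. -/
def idNorm (p : ℝ) (ω : ℝ → ℝ) (q : ℝ) (μ : Measure ℂ) : ℝ≥0∞ :=
  ⨆ f ∈ bergmanSpace p ω, lpNorm q μ f / bergmanNorm p ω f

/-- The supremum of `∫_𝔻 ∏ |f_i|^{q_i} dμ / ∏ ‖f_i‖^{q_i}` over `f_i ∈ A^{p_i}_{ω_i}`.
If some `f_i` vanishes identically, the quotient is `0 / 0 = 0`. -/
def multiNorm {n : ℕ} (p q : Fin n → ℝ) (ω : Fin n → ℝ → ℝ) (μ : Measure ℂ) : ℝ≥0∞ :=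
  ⨆ (f : Fin n → ℂ → ℂ) (_ : ∀ i, f i ∈ bergmanSpace (p i) (ω i)),
    (∫⁻ z in disc, ∏ i, ‖f i z‖ₑ ^ q i ∂μ) / ∏ i, bergmanNorm (p i) (ω i) (f i) ^ q i

/-- The exponent `λ = ∑ q_i / p_i`. -/
def totalExponent {n : ℕ} (p q : Fin n → ℝ) : ℝ := ∑ i, q i / p i

/-- The weight `ω = ∏ ω_i ^ (q_i / (λ p_i))`. -/
def productWeight {n : ℕ} (p q : Fin n → ℝ) (ω : Fin n → ℝ → ℝ) (r : ℝ) : ℝ :=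
  ∏ i, ω i r ^ (q i / (totalExponent p q * p i))

end WeightedBergman

end

/-! Both the multilinear inequality and the linear one are equivalent, up to constants independent
of `μ`, to the same discrete inequality `SeqBound` over a lattice `u` of the disc: `∑ μ(cell a) y_a
^ λ / W(a) ≤ N (∑ y_a) ^ λ` for all finite nonnegative families `y` on `u`. The discrete inequality
sees only `λ` and `W(a) = ∏ cellWeight (v i) a ^ (q_i / p_i)`. By `prod_cellWeight_rpow` this `W` is
the `λ`-th power of the cell weight of the geometric mean of the weights. Hence the data `(p_i, q_i,
ω_i)` can be replaced by the single weight `ω` with any exponents `P, Q` such that `Q / P = λ`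
(`exists_multiBound_iff_single`). The pair `(1, λ)` gives the Carleson statement and the pair `(1/λ,
1)` gives the norm estimate. No distinction between `λ ≥ 1` and `λ < 1` is needed.

From discrete to multilinear (`SeqBound.multiBound`): the local `L^p` bound controls `|f_i|` on a
cell by its weighted integral `X_i(a)` over the enlarged cell. The discrete inequality is then
applied to `y_a = ∏ X_i(a) ^ θ_i` with `θ_i = q_i / (p_i λ)`; Hölder and the bounded overlap of the
enlarged cells control `∑ y_a`.

From multilinear to discrete (`MultiBound.seqBound`): the test functions are sums over the lattice
of powers of normalized kernels with independent random signs for each index `i`. Their norms are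
controlled by `∑ y_a` (`PowerType.lintegral_kernelSum_le`), while the average over signs of `|f_i| ^
q_i` on the cell of `a` is at least a multiple of the single term belonging to `a`.

All estimates are made for weights of power type. A regular weight is equivalent to one
(`IsRegularWeight.exists_powerType`), because its tail satisfies a differential inequality in the
variable `log (1 / (1 - r))` and so lies between two powers of `1 - r`. -/

noncomputable section

namespace WeightedBergman

open Set Metric Filter Topology

/-! ### Mean values over circles and discs -/

/-- Integration in polar coordinates centred at `c`. -/
theorem lintegral_eq_lintegral_circleMap (c : ℂ) {g : ℂ → ℝ≥0∞} (hg : Measurable g) :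
    ∫⁻ z, g z = ∫⁻ r in Ioi (0 : ℝ), ENNReal.ofReal r *
      ∫⁻ θ in Ioo (-Real.pi) Real.pi, g (circleMap c r θ) := by
  rw [← lintegral_add_left_eq_self g c, ← Complex.lintegral_comp_polarCoord_symm,
    polarCoord_target, Measure.volume_eq_prod, ← Measure.prod_restrict, lintegral_prod]
  · refine lintegral_congr fun r => ?_
    rw [← lintegral_const_mul]
    · refine lintegral_congr fun θ => ?_
      simp [circleMap, Complex.exp_mul_I]
    · exact hg.comp (continuous_circleMap c r).measurable
  · have : Measurable fun p : ℝ × ℝ => Complex.polarCoord.symm p := by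
      have : (fun p : ℝ × ℝ => Complex.polarCoord.symm p) = fun p : ℝ × ℝ =>
        (p.1 * (Real.cos p.2 + Real.sin p.2 * Complex.I) : ℂ) := by
          ext p; simp
      rw [this]
      fun_prop
    have h2 : Measurable fun p : ℝ × ℝ => ENNReal.ofReal p.1 := by fun_prop
    exact (h2.smul (hg.comp (this.const_add c))).aemeasurable

theorem integral_circleMap_eq {E : Type*} [NormedAddCommGroup E] [NormedSpace ℝ E]
    (f : ℂ → E) (c : ℂ) (r : ℝ) :
    ∫ θ in Ioo (-Real.pi) Real.pi, f (circleMap c r θ) =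
      (2 * Real.pi) • Real.circleAverage f c r := by
  rw [Real.circleAverage_eq_integral_add (-Real.pi),
    intervalIntegral.integral_comp_add_right (fun θ ↦ f (circleMap c r θ)), smul_smul,
    mul_inv_cancel₀ (by positivity), one_smul,
    intervalIntegral.integral_of_le (by linarith [Real.pi_pos]), integral_Ioc_eq_integral_Ioo]
  congr 3 <;> ring

/-- The sub-mean-value property over a circle. -/
theorem enorm_le_lintegral_circleMap {f : ℂ → ℂ} {c : ℂ} {r : ℝ} (hr : 0 ≤ r)
    (hf : DiffContOnCl ℂ f (ball c r)) :
    ENNReal.ofReal (2 * Real.pi) * ‖f c‖ₑ ≤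
      ∫⁻ θ in Ioo (-Real.pi) Real.pi, ‖f (circleMap c r θ)‖ₑ := by
  refine le_trans (le_of_eq ?_) (enorm_integral_le_lintegral_enorm _)
  rw [integral_circleMap_eq, DiffContOnCl.circleAverage (by rwa [abs_of_nonneg hr]), enorm_smul,
    Real.enorm_of_nonneg (by positivity)]

/-- The sub-mean-value property over a disc. -/
theorem enorm_mul_volume_le_lintegral_ball {f : ℂ → ℂ} {c : ℂ} {R : ℝ}
    (hf : DifferentiableOn ℂ f (ball c R)) :
    ‖f c‖ₑ * volume (ball c R) ≤ ∫⁻ z in ball c R, ‖f z‖ₑ := by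
  have hmem : ∀ r ∈ Ioi (0 : ℝ), ∀ θ, circleMap c r θ ∈ ball c R ↔ r < R := by
    intro r hr θ
    rw [mem_ball, dist_eq_norm, circleMap_sub_center, norm_circleMap_zero,
      abs_of_pos (mem_Ioi.1 hr)]
  have hm : Measurable ((ball c R).indicator fun z => ‖f z‖ₑ) := by
    classical
    rw [← Set.piecewise_eq_indicator]
    exact ContinuousOn.measurable_piecewise hf.continuousOn.enorm continuousOn_const
      measurableSet_ball
  rw [← setLIntegral_const, ← lintegral_indicator measurableSet_ball,
    ← lintegral_indicator measurableSet_ball, lintegral_eq_lintegral_circleMap c hm,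
    lintegral_eq_lintegral_circleMap c (measurable_const.indicator measurableSet_ball)]
  refine setLIntegral_mono' measurableSet_Ioi fun r hr => ?_
  gcongr ENNReal.ofReal r * ?_
  by_cases hrR : r < R
  · have h1 : ∀ (g : ℂ → ℝ≥0∞) θ, (ball c R).indicator g (circleMap c r θ) = g (circleMap c r θ) :=
      fun g θ => indicator_of_mem ((hmem r hr θ).2 hrR) _
    simp only [h1]
    have h2 : DiffContOnCl ℂ f (ball c r) := by
      refine DifferentiableOn.diffContOnCl (hf.mono ?_)
      rw [closure_ball c (ne_of_gt hr)]
      exact closedBall_subset_ball hrR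
    refine le_trans (le_of_eq ?_) (enorm_le_lintegral_circleMap (le_of_lt hr) h2)
    rw [setLIntegral_const, Real.volume_Ioo, mul_comm]
    congr 2
    ring
  · have h1 : ∀ (g : ℂ → ℝ≥0∞) θ, (ball c R).indicator g (circleMap c r θ) = 0 :=
      fun g θ => indicator_of_notMem (fun h => hrR ((hmem r hr θ).1 h)) _
    simp only [h1]
    exact le_rfl

theorem one_sub_conj_mul_ne_zero {a w : ℂ} (ha : ‖a‖ < 1) (hw : ‖w‖ < 1) :
    1 - (starRingEnd ℂ) a * w ≠ 0 := by
  intro h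
  have h1 : ‖(starRingEnd ℂ) a * w‖ = 1 := by
    rw [← sub_eq_zero.1 h]; simp
  rw [norm_mul, RCLike.norm_conj] at h1
  nlinarith [norm_nonneg a, norm_nonneg w]

/-- The Poisson integral of the constant function, in the form used for kernel estimates. -/
theorem lintegral_inv_norm_sq_circleMap {a : ℂ} {r : ℝ} (ha : ‖a‖ < 1) (hr : 0 ≤ r) (hr1 : r < 1) :
    ∫⁻ θ in Ioo (-Real.pi) Real.pi,
        ENNReal.ofReal ((‖1 - (starRingEnd ℂ) a * circleMap 0 r θ‖ ^ 2)⁻¹) =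
      ENNReal.ofReal (2 * Real.pi / (1 - ‖a‖ ^ 2 * r ^ 2)) := by
  -- The real part of `F` is `(1 - |āw|²) / |1 - āw|²`, which on the circle is a constant multiple
  -- of the integrand, and the circle average of `F` is `F 0 = 1`.
  set F : ℂ → ℂ := fun w => (1 + (starRingEnd ℂ) a * w) / (1 - (starRingEnd ℂ) a * w) with hF
  have hden : 0 < 1 - ‖a‖ ^ 2 * r ^ 2 := by
    have : ‖a‖ * r < 1 := by nlinarith [norm_nonneg a]
    have h0 : 0 ≤ ‖a‖ * r := by positivity
    nlinarith
  have hne : ∀ w ∈ closedBall (0 : ℂ) r, 1 - (starRingEnd ℂ) a * w ≠ 0 := by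
    intro w hw
    exact one_sub_conj_mul_ne_zero ha (lt_of_le_of_lt (by simpa using hw) hr1)
  have hd : DifferentiableOn ℂ F (closedBall 0 r) := by
    intro w hw
    refine DifferentiableWithinAt.div (by fun_prop) (by fun_prop) (hne w hw)
  have havg : Real.circleAverage F 0 r = 1 := by
    rw [DiffContOnCl.circleAverage]
    · simp [hF]
    · rw [abs_of_nonneg hr]
      exact DifferentiableOn.diffContOnCl (hd.mono closure_ball_subset_closedBall)
  have hcont : Continuous fun θ => F (circleMap 0 r θ) :=
    hd.continuousOn.comp_continuous (continuous_circleMap 0 r)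
      fun θ => circleMap_mem_closedBall _ hr θ
  have hre : ∀ θ, (‖1 - (starRingEnd ℂ) a * circleMap 0 r θ‖ ^ 2)⁻¹ =
      (1 - ‖a‖ ^ 2 * r ^ 2)⁻¹ * (F (circleMap 0 r θ)).re := by
    intro θ
    have h1 := hne _ (circleMap_mem_closedBall (0 : ℂ) hr θ)
    set x := (starRingEnd ℂ) a * circleMap 0 r θ with hx
    have hnx : ‖x‖ ^ 2 = ‖a‖ ^ 2 * r ^ 2 := by
      simp [hx, mul_pow]
    have hxx : (F (circleMap 0 r θ)).re = (1 - ‖x‖ ^ 2) / ‖1 - x‖ ^ 2 := by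
      simp only [hF, ← hx, Complex.div_re, ← Complex.normSq_eq_norm_sq]
      rw [← add_div]
      congr 1
      simp [Complex.normSq_apply]
      ring
    rw [hxx, hnx]
    field_simp
  have hintegral : IntegrableOn (fun θ => (F (circleMap 0 r θ)).re) (Ioo (-Real.pi) Real.pi) :=
    ((Complex.continuous_re.comp hcont).continuousOn.integrableOn_Icc).mono_set Ioo_subset_Icc_self
  have hintF : IntegrableOn (fun θ => F (circleMap 0 r θ)) (Ioo (-Real.pi) Real.pi) :=
    (hcont.continuousOn.integrableOn_Icc).mono_set Ioo_subset_Icc_self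
  rw [← ofReal_integral_eq_lintegral_ofReal]
  · congr 1
    simp_rw [hre]
    rw [integral_const_mul]
    have := integral_re (𝕜 := ℂ) hintF
    simp only [RCLike.re_eq_complex_re] at this
    rw [this, integral_circleMap_eq, havg]
    simp
    field_simp
  · simp_rw [hre]
    exact hintegral.const_mul _
  · exact Filter.Eventually.of_forall fun θ => by positivity

/-! ### The local `L^p` bound for all positive exponents -/

/-- A point near the centre at which an analytic function dominates its own values on a disc. -/
theorem exists_ball_norm_le {f : ℂ → ℂ} {c : ℂ} {R s : ℝ} (hR : 0 < R) (hs : 0 < s)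
    (hf : ContinuousOn f (closedBall c R)) (hc : f c ≠ 0) :
    ∃ z d, 0 < d ∧ ball z (d / 2) ⊆ ball c R ∧ f z ≠ 0 ∧
      (∀ w ∈ ball z (d / 2), ‖f w‖ ≤ 2 ^ s * ‖f z‖) ∧ R ^ s * ‖f c‖ ≤ d ^ s * ‖f z‖ := by
  -- Take `z` maximizing `(distance to the boundary) ^ s * |f|` and let `d` be its own distance.
  -- Points within `d / 2` of `z` are still at distance at least `d / 2` from the boundary, whence
  -- the factor `2 ^ s`; comparison with the centre gives the last inequality.
  have hG : ContinuousOn (fun z => (R - dist z c) ^ s * ‖f z‖) (closedBall c R) := by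
    refine ContinuousOn.mul (ContinuousOn.rpow_const (by fun_prop) fun _ _ => Or.inr hs.le) hf.norm
  obtain ⟨z, hz, hmax⟩ := (isCompact_closedBall c R).exists_isMaxOn
    ⟨c, mem_closedBall_self hR.le⟩ hG
  have hle : ∀ w ∈ closedBall c R,
      (R - dist w c) ^ s * ‖f w‖ ≤ (R - dist z c) ^ s * ‖f z‖ := fun w hw => hmax hw
  have hcz := hle c (mem_closedBall_self hR.le)
  rw [dist_self, sub_zero] at hcz
  have hpos : 0 < (R - dist z c) ^ s * ‖f z‖ :=
    lt_of_lt_of_le (mul_pos (Real.rpow_pos_of_pos hR s) (norm_pos_iff.2 hc)) hcz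
  have hd0 : 0 ≤ R - dist z c := by
    have := mem_closedBall.1 hz
    linarith
  have hd : 0 < R - dist z c := by
    rcases hd0.eq_or_lt with h | h
    · rw [← h, Real.zero_rpow hs.ne', zero_mul] at hpos
      exact absurd hpos (lt_irrefl _)
    · exact h
  have hball : ∀ w ∈ ball z ((R - dist z c) / 2), dist w c < R ∧
      (R - dist z c) / 2 ≤ R - dist w c := by
    intro w hw
    have h1 := mem_ball.1 hw
    have h2 := dist_triangle w z c
    constructor <;> linarith
  refine ⟨z, R - dist z c, hd, fun w hw => (hball w hw).1, ?_, ?_, hcz⟩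
  · intro h
    simp [h] at hpos
  · intro w hw
    have h1 := hle w (mem_closedBall.2 (hball w hw).1.le)
    have h2 : ((R - dist z c) / 2) ^ s * ‖f w‖ ≤ (R - dist w c) ^ s * ‖f w‖ := by
      gcongr
      exact (hball w hw).2
    have h3 := h2.trans h1
    rw [Real.div_rpow hd.le (by norm_num), div_mul_eq_mul_div, div_le_iff₀ (by positivity),
      mul_assoc] at h3
    have h4 := le_of_mul_le_mul_left h3 (Real.rpow_pos_of_pos hd s)
    linarith

/-- For `p ≤ 1` the area mean value property bounds `|f|` by an `L^1` mean only. At the point `z` of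
`exists_ball_norm_le`, however, `|f| ≤ K |f z|` nearby, so `|f| ≤ (K |f z|) ^ (1 - p) |f| ^ p`, and
the power of `|f z|` can be divided out. -/
theorem enorm_rpow_mul_sq_le_of_le_one {p : ℝ} (hp : 0 < p) (hp1 : p ≤ 1) :
    ∃ C : ℝ≥0, ∀ (f : ℂ → ℂ) (c : ℂ) (ρ : ℝ), 0 < ρ → DifferentiableOn ℂ f (ball c ρ) →
      ‖f c‖ₑ ^ p * ENNReal.ofReal (ρ ^ 2) ≤ C * ∫⁻ z in ball c ρ, ‖f z‖ₑ ^ p := by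
  set K : ℝ≥0 := (2 : ℝ≥0) ^ (2 / p) with hK
  refine ⟨16 * K ^ (1 - p), fun f c ρ hρ hf => ?_⟩
  by_cases hc : f c = 0
  · simp [hc, hp]
  have hR : 0 < ρ / 2 := by positivity
  -- The exponent is `2 / p` so that the `p`-th power of the comparison between `c` and `z` carries
  -- the squares of the radii, that is, areas. The radius is halved so that the closed disc lies
  -- where `f` is analytic.
  obtain ⟨z, d, hd, hsub, hz, hle, hmax⟩ := exists_ball_norm_le hR (show 0 < 2 / p by positivity)
    (hf.continuousOn.mono (closedBall_subset_ball (by linarith))) hc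
  have hsub' : ball z (d / 2) ⊆ ball c ρ := hsub.trans (ball_subset_ball (by linarith))
  have hle' : ∀ w ∈ ball z (d / 2), ‖f w‖ₑ ≤ K * ‖f z‖ₑ := by
    intro w hw
    have h := hle w hw
    have : ‖f w‖₊ ≤ K * ‖f z‖₊ := by
      rw [← NNReal.coe_le_coe]
      simpa [hK] using h
    rw [enorm_eq_nnnorm, enorm_eq_nnnorm]
    exact_mod_cast this
  set x := ‖f z‖ₑ with hx
  have hx0 : x ≠ 0 := by simpa [hx] using hz
  have hxt : x ≠ ∞ := by simp [hx]
  set I := ∫⁻ w in ball c ρ, ‖f w‖ₑ ^ p with hI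
  have h1 : x * volume (ball z (d / 2)) ≤ (K * x) ^ (1 - p) * I := by
    refine (enorm_mul_volume_le_lintegral_ball (hf.mono hsub')).trans ?_
    calc ∫⁻ w in ball z (d / 2), ‖f w‖ₑ
        ≤ ∫⁻ w in ball z (d / 2), (K * x) ^ (1 - p) * ‖f w‖ₑ ^ p := by
          refine setLIntegral_mono' measurableSet_ball fun w hw => ?_
          calc ‖f w‖ₑ = ‖f w‖ₑ ^ (1 - p) * ‖f w‖ₑ ^ p := by
                rw [← ENNReal.rpow_add_of_nonneg _ _ (by linarith) hp.le]
                simp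
            _ ≤ _ := by
                gcongr
                exact hle' w hw
      _ = (K * x) ^ (1 - p) * ∫⁻ w in ball z (d / 2), ‖f w‖ₑ ^ p := by
          refine lintegral_const_mul' _ _ ?_
          exact ENNReal.rpow_ne_top_of_nonneg (by linarith) (ENNReal.mul_ne_top (by simp) hxt)
      _ ≤ _ := by
          gcongr
          exact lintegral_mono_set hsub'
  have h2 : x ^ p * volume (ball z (d / 2)) ≤ (K : ℝ≥0∞) ^ (1 - p) * I := by
    have hxp0 : x ^ (1 - p) ≠ 0 := by simp [hx0, hxt]
    have hxpt : x ^ (1 - p) ≠ ∞ := ENNReal.rpow_ne_top_of_nonneg (by linarith) hxt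
    rw [← ENNReal.mul_le_mul_iff_right hxp0 hxpt, ← mul_assoc, ← mul_assoc,
      ← ENNReal.rpow_add_of_nonneg _ _ (by linarith) hp.le]
    rw [ENNReal.mul_rpow_of_nonneg _ _ (by linarith), mul_comm _ (x ^ (1 - p))] at h1
    simpa using h1
  have h3 : ENNReal.ofReal (d ^ 2) ≤ 4 * volume (ball z (d / 2)) := by
    rw [Complex.volume_ball, ENNReal.ofReal_pow hd.le]
    have : (4 : ℝ≥0∞) * (ENNReal.ofReal (d / 2) ^ 2 * NNReal.pi) =
        ENNReal.ofReal d ^ 2 * NNReal.pi := by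
      rw [ENNReal.ofReal_div_of_pos (by norm_num), ENNReal.div_eq_inv_mul, mul_pow, ← mul_assoc,
        ← mul_assoc, ← ENNReal.inv_pow]
      norm_num
      rw [ENNReal.mul_inv_cancel (by norm_num) (by norm_num), one_mul]
    rw [this]
    refine le_mul_of_one_le_right (zero_le) ?_
    have : (1 : ℝ≥0) ≤ NNReal.pi := by
      rw [← NNReal.coe_le_coe]
      simpa using (by linarith [Real.pi_gt_three] : (1 : ℝ) ≤ Real.pi)
    exact_mod_cast this
  have h4 : ENNReal.ofReal (ρ ^ 2) * ‖f c‖ₑ ^ p ≤ 4 * (ENNReal.ofReal (d ^ 2) * x ^ p) := by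
    have e1 : ∀ (r : ℝ) (y : ℂ), 0 < r → (ENNReal.ofReal (r ^ (2 / p) * ‖y‖)) ^ p =
        ENNReal.ofReal (r ^ 2) * ‖y‖ₑ ^ p := by
      intro r y hr
      rw [ENNReal.ofReal_mul (by positivity), ENNReal.mul_rpow_of_nonneg _ _ hp.le, ofReal_norm,
        ENNReal.ofReal_rpow_of_pos (by positivity), ← Real.rpow_mul hr.le,
        div_mul_cancel₀ _ hp.ne']
      norm_num
    have e2 := ENNReal.rpow_le_rpow (ENNReal.ofReal_le_ofReal hmax) hp.le
    rw [e1 _ _ hR, e1 _ _ hd] at e2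
    have e3 : ENNReal.ofReal (ρ ^ 2) = 4 * ENNReal.ofReal ((ρ / 2) ^ 2) := by
      rw [show (4 : ℝ≥0∞) = ENNReal.ofReal 4 by simp, ← ENNReal.ofReal_mul (by norm_num)]
      congr 1
      ring
    rw [e3, mul_assoc]
    gcongr
  calc ‖f c‖ₑ ^ p * ENNReal.ofReal (ρ ^ 2) ≤ 4 * (ENNReal.ofReal (d ^ 2) * x ^ p) := by
        rw [mul_comm]; exact h4
    _ ≤ 4 * (4 * volume (ball z (d / 2)) * x ^ p) := by gcongr
    _ = 16 * (x ^ p * volume (ball z (d / 2))) := by ring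
    _ ≤ 16 * ((K : ℝ≥0∞) ^ (1 - p) * I) := by gcongr
    _ = _ := by
        push_cast
        rw [ENNReal.coe_rpow_of_nonneg _ (by linarith : 0 ≤ 1 - p), mul_assoc]

/-- The local `L^p` bound for analytic functions, for every exponent `0 < p < ∞`. -/
theorem enorm_rpow_mul_sq_le {p : ℝ} (hp : 0 < p) :
    ∃ C : ℝ≥0, ∀ (f : ℂ → ℂ) (c : ℂ) (ρ : ℝ), 0 < ρ → DifferentiableOn ℂ f (ball c ρ) →
      ‖f c‖ₑ ^ p * ENNReal.ofReal (ρ ^ 2) ≤ C * ∫⁻ z in ball c ρ, ‖f z‖ₑ ^ p := by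
  obtain ⟨k, hk⟩ := exists_nat_ge p
  have hk0 : (0 : ℝ) < k := hp.trans_le hk
  obtain ⟨C, hC⟩ := enorm_rpow_mul_sq_le_of_le_one (show 0 < p / k by positivity)
    ((div_le_one hk0).2 hk)
  refine ⟨C, fun f c ρ hρ hf => ?_⟩
  -- Large exponents reduce to small ones since `f ^ k` is analytic and `|f ^ k| ^ (p / k) = |f| ^
  -- p`.
  have h := hC (fun z => f z ^ k) c ρ hρ (hf.pow k)
  have e : ∀ z, ‖f z ^ k‖ₑ ^ (p / k) = ‖f z‖ₑ ^ p := by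
    intro z
    rw [enorm_pow, ← ENNReal.rpow_natCast, ← ENNReal.rpow_mul, mul_div_cancel₀ _ hk0.ne']
  simpa only [e] using h

/-! ### Weights of power type -/

/-- Weights `v` on `[0,1)` for which `(1 - r) v(r)` lies between two powers of `1 - r`, in the sense
that its quotients are controlled by the corresponding quotients of powers. -/
structure PowerType (v : ℝ → ℝ) (a b : ℝ) : Prop where
  measurable : Measurable v
  pos : ∀ r ∈ Ico (0 : ℝ) 1, 0 < v r
  upper : ∀ r s, 0 ≤ r → r ≤ s → s < 1 →
    v s * (1 - s) ≤ v r * (1 - r) * ((1 - s) / (1 - r)) ^ a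
  lower : ∀ r s, 0 ≤ r → r ≤ s → s < 1 →
    v r * (1 - r) * ((1 - s) / (1 - r)) ^ b ≤ v s * (1 - s)

theorem PowerType.one_sub_rpow_mul {v : ℝ → ℝ} {a b : ℝ} (h : PowerType v a b) (e : ℝ) :
    PowerType (fun r => (1 - r) ^ e * v r) (a + e) (b + e) := by
  have key : ∀ r s c : ℝ, 0 ≤ r → r ≤ s → s < 1 →
      (1 - r) ^ e * v r * (1 - r) * ((1 - s) / (1 - r)) ^ (c + e) =
        (1 - s) ^ e * (v r * (1 - r) * ((1 - s) / (1 - r)) ^ c) := by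
    intro r s c hr hrs hs
    have h1 : 0 < 1 - r := by linarith
    have h2 : 0 < 1 - s := by linarith
    rw [Real.rpow_add (by positivity), Real.div_rpow h2.le h1.le e]
    field_simp
  refine ⟨(by fun_prop : Measurable fun r : ℝ => (1 - r) ^ e).mul h.measurable, fun r hr => ?_,
    fun r s hr hrs hs => ?_, fun r s hr hrs hs => ?_⟩
  · exact mul_pos (Real.rpow_pos_of_pos (by linarith [hr.2]) _) (h.pos r hr)
  · rw [key r s a hr hrs hs, mul_assoc]
    exact mul_le_mul_of_nonneg_left (h.upper r s hr hrs hs) (Real.rpow_nonneg (by linarith) _)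
  · rw [key r s b hr hrs hs, mul_assoc _ (v s)]
    exact mul_le_mul_of_nonneg_left (h.lower r s hr hrs hs) (Real.rpow_nonneg (by linarith) _)

theorem powerType_one_sub_rpow (e : ℝ) : PowerType (fun r => (1 - r) ^ e) (e + 1) (e + 1) := by
  have key : ∀ r s : ℝ, 0 ≤ r → r ≤ s → s < 1 →
      (1 - s) ^ e * (1 - s) = (1 - r) ^ e * (1 - r) * ((1 - s) / (1 - r)) ^ (e + 1) := by
    intro r s hr hrs hs
    have h1 : 0 < 1 - r := by linarith
    have h2 : 0 < 1 - s := by linarith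
    rw [Real.div_rpow h2.le h1.le, Real.rpow_add_one h1.ne', Real.rpow_add_one h2.ne']
    field_simp
  exact ⟨by fun_prop, fun r hr => Real.rpow_pos_of_pos (by linarith [hr.2]) _,
    fun r s hr hrs hs => (key r s hr hrs hs).le, fun r s hr hrs hs => (key r s hr hrs hs).ge⟩

/-- A weight of power type is essentially constant where `1 - r` is. -/
theorem PowerType.le_of_comparable {v : ℝ → ℝ} {a b : ℝ} (h : PowerType v a b) (ha : 0 ≤ a)
    (hb : 0 ≤ b) {r s : ℝ} (hr : r ∈ Ico (0 : ℝ) 1) (hs : s ∈ Ico (0 : ℝ) 1)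
    (h1 : 1 - r ≤ 2 * (1 - s)) (h2 : 1 - s ≤ 2 * (1 - r)) : v s ≤ 2 ^ (b + 1) * v r := by
  have hr1 : 0 < 1 - r := by linarith [hr.2]
  have hs1 : 0 < 1 - s := by linarith [hs.2]
  have hvr := h.pos r hr
  have hvs := h.pos s hs
  have h2b : (1 : ℝ) ≤ 2 ^ b := Real.one_le_rpow (by norm_num) hb
  rw [Real.rpow_add_one (by norm_num)]
  rcases le_total r s with hrs | hrs
  · have := h.upper r s hr.1 hrs hs.2
    have h3 : ((1 - s) / (1 - r)) ^ a ≤ 1 :=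
      Real.rpow_le_one (by positivity) ((div_le_one hr1).2 (by linarith)) ha
    have h4 : v s * (1 - s) ≤ v r * (1 - r) :=
      this.trans (mul_le_of_le_one_right (by positivity) h3)
    have h5 : v s * (1 - s) ≤ (2 * v r) * (1 - s) := by nlinarith
    have h6 := le_of_mul_le_mul_right h5 hs1
    nlinarith
  · have := h.lower s r hs.1 hrs hr.2
    have h3 : (1 / 2 : ℝ) ^ b ≤ ((1 - r) / (1 - s)) ^ b := by
      refine Real.rpow_le_rpow (by norm_num) ?_ hb
      rw [div_le_div_iff₀ (by norm_num) hs1]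
      linarith
    have h4 : v s * (1 - s) * (1 / 2) ^ b ≤ v r * (1 - r) :=
      (mul_le_mul_of_nonneg_left h3 (by positivity)).trans this
    rw [Real.div_rpow (by norm_num) (by norm_num), Real.one_rpow, mul_one_div,
      div_le_iff₀ (by positivity)] at h4
    have h5 : v s * (1 - s) ≤ (v r * 2 ^ b) * (1 - s) := by
      refine h4.trans ?_
      have : v r * (1 - r) ≤ v r * (1 - s) := by gcongr
      nlinarith
    have h6 := le_of_mul_le_mul_right h5 hs1
    nlinarith [mul_pos hvr (by positivity : (0 : ℝ) < 2 ^ b)]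

theorem lintegral_one_sub_rpow {e x y : ℝ} (hxy : x ≤ y) (hy : y ≤ 1)
    (hi : IntervalIntegrable (fun t : ℝ => t ^ e) volume (1 - y) (1 - x)) :
    ∫⁻ r in Ioc x y, ENNReal.ofReal ((1 - r) ^ e) =
      ENNReal.ofReal (∫ t in (1 - y)..(1 - x), t ^ e) := by
  have hi' : IntervalIntegrable (fun r : ℝ => (1 - r) ^ e) volume x y := by
    have := (hi.comp_sub_left 1).symm
    simpa using this
  rw [← intervalIntegral.integral_comp_sub_left (fun t : ℝ => t ^ e),
    intervalIntegral.integral_of_le hxy, ofReal_integral_eq_lintegral_ofReal]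
  · exact (intervalIntegrable_iff_integrableOn_Ioc_of_le hxy).1 hi'
  · refine (ae_restrict_iff' measurableSet_Ioc).2 (Filter.Eventually.of_forall fun r hr => ?_)
    exact Real.rpow_nonneg (by linarith [hr.2]) _

theorem lintegral_one_sub_rpow_tail {a ρ : ℝ} (ha : 0 < a) (hρ : ρ < 1) :
    ∫⁻ r in Ioc ρ 1, ENNReal.ofReal ((1 - r) ^ (a - 1)) = ENNReal.ofReal ((1 - ρ) ^ a / a) := by
  rw [lintegral_one_sub_rpow hρ.le le_rfl]
  · rw [sub_self, integral_rpow (Or.inl (by linarith)), sub_add_cancel, Real.zero_rpow ha.ne',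
      sub_zero]
  · exact intervalIntegral.intervalIntegrable_rpow' (by linarith)

theorem lintegral_one_sub_rpow_head {c ρ : ℝ} (hc : 0 < c) (h0 : 0 ≤ ρ) (hρ : ρ < 1) :
    ∫⁻ r in Ioc 0 ρ, ENNReal.ofReal ((1 - r) ^ (-c - 1)) ≤ ENNReal.ofReal ((1 - ρ) ^ (-c) / c) := by
  have hnot : (0 : ℝ) ∉ uIcc (1 - ρ) (1 - 0) := by
    rw [uIcc_of_le (by linarith)]
    intro h
    linarith [h.1]
  rw [lintegral_one_sub_rpow h0 hρ.le]
  · rw [integral_rpow (Or.inr ⟨by linarith, hnot⟩), sub_add_cancel, sub_zero, Real.one_rpow]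
    refine ENNReal.ofReal_le_ofReal ?_
    rw [div_neg, ← neg_div]
    gcongr
    linarith
  · exact intervalIntegral.intervalIntegrable_rpow (Or.inr hnot)

/-! ### Integral estimates for the kernel -/

/-- The modulus of the normalized kernel `(1 - |a|) / (1 - conj a * z)`. -/
def kernelNorm (a z : ℂ) : ℝ := (1 - ‖a‖) / ‖1 - (starRingEnd ℂ) a * z‖

theorem one_sub_mul_le_norm (a z : ℂ) : 1 - ‖a‖ * ‖z‖ ≤ ‖1 - (starRingEnd ℂ) a * z‖ := by
  have := norm_sub_norm_le (1 : ℂ) ((starRingEnd ℂ) a * z)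
  rwa [norm_one, norm_mul, RCLike.norm_conj] at this

theorem measurable_kernelNorm (a : ℂ) : Measurable (kernelNorm a) := by
  unfold kernelNorm
  fun_prop

theorem mem_disc {z : ℂ} : z ∈ disc ↔ ‖z‖ < 1 := by simp [disc]

theorem isOpen_disc : IsOpen disc := isOpen_ball

theorem measurableSet_disc : MeasurableSet disc := isOpen_disc.measurableSet

theorem norm_mem_Ico {z : ℂ} (hz : z ∈ disc) : ‖z‖ ∈ Ico (0 : ℝ) 1 := ⟨norm_nonneg z, mem_disc.1 hz⟩

/-- The angular integral of a power of the kernel. -/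
theorem lintegral_kernelNorm_circleMap_le {M : ℝ} (hM : 2 ≤ M) {a : ℂ} (ha : ‖a‖ < 1) {r : ℝ}
    (hr : 0 ≤ r) (hr1 : r < 1) :
    ∫⁻ θ in Ioo (-Real.pi) Real.pi, ENNReal.ofReal (kernelNorm a (circleMap 0 r θ) ^ M) ≤
      ENNReal.ofReal (2 * Real.pi * ((1 - ‖a‖) ^ M * (1 - ‖a‖ * r) ^ (1 - M))) := by
  have hh : 0 < 1 - ‖a‖ := by linarith
  have hd : 0 < 1 - ‖a‖ * r := by nlinarith [norm_nonneg a]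
  have hpt : ∀ θ, kernelNorm a (circleMap 0 r θ) ^ M ≤ (1 - ‖a‖) ^ M * (1 - ‖a‖ * r) ^ (2 - M) *
      (‖1 - (starRingEnd ℂ) a * circleMap 0 r θ‖ ^ 2)⁻¹ := by
    intro θ
    have h1 : 1 - ‖a‖ * r ≤ ‖1 - (starRingEnd ℂ) a * circleMap 0 r θ‖ := by
      have := one_sub_mul_le_norm a (circleMap 0 r θ)
      rwa [norm_circleMap_zero, abs_of_nonneg hr] at this
    have hx := hd.trans_le h1
    rw [kernelNorm, Real.div_rpow hh.le hx.le, div_eq_mul_inv, mul_assoc]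
    gcongr
    set x := ‖1 - (starRingEnd ℂ) a * circleMap 0 r θ‖
    have h2 : x ^ (2 - M) ≤ (1 - ‖a‖ * r) ^ (2 - M) :=
      Real.rpow_le_rpow_of_nonpos hd h1 (by linarith)
    -- As `M ≥ 2`, all but two of the factors are estimated by the minimum of `x` on the circle; the
    -- remaining square is the Poisson integral.
    calc (x ^ M)⁻¹ = x ^ (2 - M) * (x ^ 2)⁻¹ := by
          rw [Real.rpow_sub hx, Real.rpow_two]
          field_simp
      _ ≤ _ := by gcongr
  calc ∫⁻ θ in Ioo (-Real.pi) Real.pi, ENNReal.ofReal (kernelNorm a (circleMap 0 r θ) ^ M)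
      ≤ ∫⁻ θ in Ioo (-Real.pi) Real.pi, ENNReal.ofReal ((1 - ‖a‖) ^ M * (1 - ‖a‖ * r) ^ (2 - M)) *
          ENNReal.ofReal ((‖1 - (starRingEnd ℂ) a * circleMap 0 r θ‖ ^ 2)⁻¹) := by
        refine lintegral_mono fun θ => ?_
        rw [← ENNReal.ofReal_mul (by positivity)]
        exact ENNReal.ofReal_le_ofReal (hpt θ)
    _ = ENNReal.ofReal ((1 - ‖a‖) ^ M * (1 - ‖a‖ * r) ^ (2 - M)) *
          ENNReal.ofReal (2 * Real.pi / (1 - ‖a‖ ^ 2 * r ^ 2)) := by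
        rw [lintegral_const_mul' _ _ ENNReal.ofReal_ne_top, lintegral_inv_norm_sq_circleMap ha hr hr1]
    _ ≤ _ := by
        rw [← ENNReal.ofReal_mul (by positivity)]
        refine ENNReal.ofReal_le_ofReal ?_
        have h3 : 2 * Real.pi / (1 - ‖a‖ ^ 2 * r ^ 2) ≤ 2 * Real.pi / (1 - ‖a‖ * r) := by
          refine div_le_div_of_nonneg_left (by positivity) hd ?_
          have : 0 ≤ ‖a‖ * r := by positivity
          nlinarith
        calc _ ≤ (1 - ‖a‖) ^ M * (1 - ‖a‖ * r) ^ (2 - M) * (2 * Real.pi / (1 - ‖a‖ * r)) := by gcongr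
          _ = _ := by
            rw [show 2 - M = (1 - M) + 1 by ring, Real.rpow_add_one hd.ne']
            field_simp

/-- The kernel estimate: the integral of a high power of the normalized kernel at `a` against a
weight of power type is comparable to the weighted area of a disc around `a` of radius about
`1 - |a|`. -/
theorem PowerType.lintegral_kernelNorm_le {v : ℝ → ℝ} {a b M : ℝ} (h : PowerType v a b)
    (ha : 0 < a) (hM : 2 ≤ M) (hbM : b + 1 < M) :
    ∃ C : ℝ≥0, ∀ α ∈ disc,
      ∫⁻ w in disc, ENNReal.ofReal (kernelNorm α w ^ M) * ENNReal.ofReal (v ‖w‖) ≤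
        C * ENNReal.ofReal ((1 - ‖α‖) ^ 2 * v ‖α‖) := by
  refine ⟨Real.toNNReal (2 * Real.pi) * (Real.toNNReal (1 / (M - b - 1)) + Real.toNNReal (1 / a)),
    fun α hα => ?_⟩
  set ρ := ‖α‖ with hρ
  have hρ0 : 0 ≤ ρ := norm_nonneg α
  have hρ1 : ρ < 1 := mem_disc.1 hα
  have hh : 0 < 1 - ρ := by linarith
  have hv := h.pos ρ ⟨hρ0, hρ1⟩
  set A : ℝ := (1 - ρ) ^ 2 * v ρ with hA
  have hA0 : 0 < A := by positivity
  have hmeas : Measurable fun w : ℂ => ENNReal.ofReal (kernelNorm α w ^ M) * ENNReal.ofReal (v ‖w‖) := by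
    have h1 := measurable_kernelNorm α
    have h2 := h.measurable
    have h3 : Measurable fun w : ℂ => v ‖w‖ := h2.comp measurable_norm
    fun_prop
  have hrad : ∀ r ∈ Ioi (0 : ℝ), ENNReal.ofReal r * ∫⁻ θ in Ioo (-Real.pi) Real.pi,
      disc.indicator (fun w : ℂ => ENNReal.ofReal (kernelNorm α w ^ M) * ENNReal.ofReal (v ‖w‖))
        (circleMap 0 r θ) ≤
      ENNReal.ofReal (2 * Real.pi) * (ENNReal.ofReal (A * (1 - ρ) ^ (M - b - 1)) *
          (Ioc 0 ρ).indicator (fun r => ENNReal.ofReal ((1 - r) ^ (-(M - b - 1) - 1))) r +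
        ENNReal.ofReal (A * (1 - ρ) ^ (-a)) *
          (Ioc ρ 1).indicator (fun r => ENNReal.ofReal ((1 - r) ^ (a - 1))) r) := by
    intro r hr
    have hr0 : 0 < r := hr
    by_cases hr1 : r < 1
    swap
    · have : ∀ θ, disc.indicator (fun w : ℂ => ENNReal.ofReal (kernelNorm α w ^ M) *
          ENNReal.ofReal (v ‖w‖)) (circleMap 0 r θ) = 0 := by
        intro θ
        refine indicator_of_notMem (fun hmem => hr1 ?_) _
        rw [mem_disc, norm_circleMap_zero, abs_of_pos hr0] at hmem
        exact hmem
      simp [this]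
    have h1r : 0 < 1 - r := by linarith
    have hd : 0 < 1 - ρ * r := by nlinarith
    have hvr := h.pos r ⟨hr0.le, hr1⟩
    have e1 : ∀ θ, disc.indicator (fun w : ℂ => ENNReal.ofReal (kernelNorm α w ^ M) *
          ENNReal.ofReal (v ‖w‖)) (circleMap 0 r θ) =
        ENNReal.ofReal (kernelNorm α (circleMap 0 r θ) ^ M) * ENNReal.ofReal (v r) := by
      intro θ
      have hn : ‖circleMap 0 r θ‖ = r := by rw [norm_circleMap_zero, abs_of_pos hr0]
      rw [indicator_of_mem (mem_disc.2 (by rwa [hn])), hn]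
    simp_rw [e1]
    rw [lintegral_mul_const' _ _ ENNReal.ofReal_ne_top]
    have e2 : ENNReal.ofReal r * ((∫⁻ θ in Ioo (-Real.pi) Real.pi,
        ENNReal.ofReal (kernelNorm α (circleMap 0 r θ) ^ M)) * ENNReal.ofReal (v r)) ≤
        ENNReal.ofReal (2 * Real.pi) *
          ENNReal.ofReal ((1 - ρ) ^ M * (1 - ρ * r) ^ (1 - M) * v r) := by
      calc _ ≤ 1 * (ENNReal.ofReal (2 * Real.pi * ((1 - ρ) ^ M * (1 - ρ * r) ^ (1 - M))) *
            ENNReal.ofReal (v r)) := by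
            gcongr
            · rw [← ENNReal.ofReal_one]
              exact ENNReal.ofReal_le_ofReal hr1.le
            · exact lintegral_kernelNorm_circleMap_le hM hρ1 hr0.le hr1
        _ = _ := by
            rw [one_mul, ← ENNReal.ofReal_mul (by positivity), ← ENNReal.ofReal_mul (by positivity)]
            congr 1
            ring
    refine e2.trans ?_
    gcongr
    -- For `r ≤ ρ`, `1 - ρ r` is bounded below by `1 - r`, and the lower growth condition leaves a
    -- negative power of `1 - r` whose integral is governed by `r = ρ` because `M > b + 1`. For `r >
    -- ρ`, it is bounded below by `1 - ρ`, and the upper condition leaves `(1 - r) ^ (a - 1)`,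
    -- integrable up to `1` because `a > 0`.
    rcases le_or_gt r ρ with hrρ | hrρ
    · rw [indicator_of_mem (show r ∈ Ioc 0 ρ from ⟨hr0, hrρ⟩)]
      refine le_trans ?_ le_self_add
      rw [← ENNReal.ofReal_mul (by positivity)]
      refine ENNReal.ofReal_le_ofReal ?_
      have h3 : (1 - ρ * r) ^ (1 - M) ≤ (1 - r) ^ (1 - M) :=
        Real.rpow_le_rpow_of_nonpos h1r (by nlinarith) (by linarith)
      have h4 := h.lower r ρ hr0.le hrρ hρ1
      have h5 : v r ≤ v ρ * (1 - ρ) * (1 - ρ) ^ (-b) * ((1 - r) ^ b * (1 - r)⁻¹) := by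
        rw [Real.div_rpow hh.le h1r.le, mul_div_assoc', div_le_iff₀ (by positivity)] at h4
        rw [Real.rpow_neg hh.le]
        field_simp
        linarith
      calc (1 - ρ) ^ M * (1 - ρ * r) ^ (1 - M) * v r
          ≤ (1 - ρ) ^ M * (1 - r) ^ (1 - M) *
            (v ρ * (1 - ρ) * (1 - ρ) ^ (-b) * ((1 - r) ^ b * (1 - r)⁻¹)) := by gcongr
        _ = A * (1 - ρ) ^ (M - b - 1) * (1 - r) ^ (-(M - b - 1) - 1) := by
            rw [hA, show M - b - 1 = M + (-b) + (-1) by ring,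
              show -(M + (-b) + (-1)) - 1 = (1 - M) + b + (-1) by ring, Real.rpow_add hh,
              Real.rpow_add hh, Real.rpow_add h1r, Real.rpow_add h1r, Real.rpow_neg_one,
              Real.rpow_neg_one]
            field_simp
    · rw [indicator_of_mem (show r ∈ Ioc ρ 1 from ⟨hrρ, hr1.le⟩)]
      refine le_trans ?_ le_add_self
      rw [← ENNReal.ofReal_mul (by positivity)]
      refine ENNReal.ofReal_le_ofReal ?_
      have h3 : (1 - ρ * r) ^ (1 - M) ≤ (1 - ρ) ^ (1 - M) :=
        Real.rpow_le_rpow_of_nonpos hh (by nlinarith) (by linarith)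
      have h4 := h.upper ρ r hρ0 hrρ.le hr1
      have h5 : v r ≤ v ρ * (1 - ρ) * (1 - ρ) ^ (-a) * ((1 - r) ^ a * (1 - r)⁻¹) := by
        rw [Real.div_rpow h1r.le hh.le, mul_div_assoc', le_div_iff₀ (by positivity)] at h4
        rw [Real.rpow_neg hh.le]
        field_simp
        linarith
      calc (1 - ρ) ^ M * (1 - ρ * r) ^ (1 - M) * v r
          ≤ (1 - ρ) ^ M * (1 - ρ) ^ (1 - M) *
            (v ρ * (1 - ρ) * (1 - ρ) ^ (-a) * ((1 - r) ^ a * (1 - r)⁻¹)) := by gcongr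
        _ = A * (1 - ρ) ^ (-a) * (1 - r) ^ (a - 1) := by
            rw [hA, Real.rpow_sub_one h1r.ne', ← Real.rpow_add hh]
            norm_num
            field_simp
  rw [← lintegral_indicator measurableSet_disc,
    lintegral_eq_lintegral_circleMap 0 (hmeas.indicator measurableSet_disc)]
  refine (setLIntegral_mono' measurableSet_Ioi hrad).trans ?_
  have hm1 : ∀ e : ℝ, Measurable fun r : ℝ => ENNReal.ofReal ((1 - r) ^ e) := fun e => by fun_prop
  rw [lintegral_const_mul' _ _ ENNReal.ofReal_ne_top, lintegral_add_left
    (((hm1 _).indicator measurableSet_Ioc).const_mul _),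
    lintegral_const_mul' _ _ ENNReal.ofReal_ne_top, lintegral_const_mul' _ _ ENNReal.ofReal_ne_top]
  have i1 : ∫⁻ r in Ioi (0 : ℝ), (Ioc 0 ρ).indicator
      (fun r => ENNReal.ofReal ((1 - r) ^ (-(M - b - 1) - 1))) r ≤
      ENNReal.ofReal ((1 - ρ) ^ (-(M - b - 1)) / (M - b - 1)) := by
    refine (setLIntegral_le_lintegral _ _).trans ?_
    rw [lintegral_indicator measurableSet_Ioc]
    exact lintegral_one_sub_rpow_head (by linarith) hρ0 hρ1
  have i2 : ∫⁻ r in Ioi (0 : ℝ), (Ioc ρ 1).indicator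
      (fun r => ENNReal.ofReal ((1 - r) ^ (a - 1))) r ≤ ENNReal.ofReal ((1 - ρ) ^ a / a) := by
    refine (setLIntegral_le_lintegral _ _).trans ?_
    rw [lintegral_indicator measurableSet_Ioc]
    exact (lintegral_one_sub_rpow_tail ha hρ1).le
  have hMb : 0 < M - b - 1 := by linarith
  calc _ ≤ ENNReal.ofReal (2 * Real.pi) * (ENNReal.ofReal (A * (1 - ρ) ^ (M - b - 1)) *
        ENNReal.ofReal ((1 - ρ) ^ (-(M - b - 1)) / (M - b - 1)) +
        ENNReal.ofReal (A * (1 - ρ) ^ (-a)) * ENNReal.ofReal ((1 - ρ) ^ a / a)) := by gcongr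
    _ = ENNReal.ofReal (2 * Real.pi) * (ENNReal.ofReal (1 / (M - b - 1)) * ENNReal.ofReal A +
        ENNReal.ofReal (1 / a) * ENNReal.ofReal A) := by
        rw [← ENNReal.ofReal_mul (by positivity), ← ENNReal.ofReal_mul (by positivity),
          ← ENNReal.ofReal_mul (by positivity), ← ENNReal.ofReal_mul (by positivity),
          Real.rpow_neg hh.le, Real.rpow_neg hh.le]
        congr 3 <;> field_simp
    _ = _ := by
        rw [← add_mul, ← mul_assoc]
        simp only [ENNReal.ofReal, ENNReal.coe_mul, ENNReal.coe_add]

/-! ### Lattices in the disc -/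

/-- A separated set of points of the disc whose hyperbolically small discs cover the disc. -/
structure IsLattice (u : Set ℂ) : Prop where
  subset_disc : u ⊆ disc
  disjoint : u.PairwiseDisjoint fun a => closedBall a ((1 - ‖a‖) / 100)
  cover : ∀ z ∈ disc, ∃ a ∈ u, z ∈ closedBall a ((1 - ‖a‖) / 20)

/-- The Vitali covering lemma for the discs of radius `(1 - |a|) / 100`, with enlargement factor
`5`, which explains the radius `(1 - |a|) / 20` in the covering. -/
theorem exists_isLattice : ∃ u : Set ℂ, IsLattice u := by
  obtain ⟨u, hu, hd, hc⟩ := Vitali.exists_disjoint_subfamily_covering_enlargement_closedBall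
    disc (fun a : ℂ => a) (fun a => (1 - ‖a‖) / 100) 1
    (fun a _ => by linarith [norm_nonneg a]) 5 (by norm_num)
  refine ⟨u, hu, hd, fun z hz => ?_⟩
  obtain ⟨a, ha, hsub⟩ := hc z hz
  refine ⟨a, ha, ?_⟩
  have h1 : 0 ≤ (1 - ‖z‖) / 100 := by linarith [mem_disc.1 hz]
  have := hsub (mem_closedBall_self h1)
  rwa [show (5 : ℝ) * ((1 - ‖a‖) / 100) = (1 - ‖a‖) / 20 by ring] at this

theorem IsLattice.countable {u : Set ℂ} (hu : IsLattice u) : u.Countable := by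
  refine hu.disjoint.countable_of_nonempty_interior fun a ha => ?_
  have h1 : 0 < (1 - ‖a‖) / 100 := by linarith [mem_disc.1 (hu.subset_disc ha)]
  rw [interior_closedBall _ h1.ne']
  exact ⟨a, mem_ball_self h1⟩

theorem one_sub_norm_bounds {a w : ℂ} (h : w ∈ closedBall a ((1 - ‖a‖) / 10)) :
    1 - ‖w‖ ≤ 11 / 10 * (1 - ‖a‖) ∧ 9 / 10 * (1 - ‖a‖) ≤ 1 - ‖w‖ := by
  rw [mem_closedBall, dist_eq_norm] at h
  have h1 := norm_sub_norm_le w a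
  have h2 := norm_sub_norm_le a w
  rw [norm_sub_rev] at h2
  constructor <;> linarith

theorem closedBall_subset_disc {a : ℂ} (ha : a ∈ disc) :
    closedBall a ((1 - ‖a‖) / 10) ⊆ disc := by
  intro w hw
  have := (one_sub_norm_bounds hw).2
  have h2 := mem_disc.1 ha
  rw [mem_disc]
  linarith

theorem closedBall_div_mono {a : ℂ} (ha : a ∈ disc) {m n : ℝ} (hm : 0 < m) (hmn : m ≤ n) :
    closedBall a ((1 - ‖a‖) / n) ⊆ closedBall a ((1 - ‖a‖) / m) := by
  refine closedBall_subset_closedBall ?_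
  have h2 := mem_disc.1 ha
  have : 0 ≤ 1 - ‖a‖ := by linarith
  gcongr

theorem PowerType.le_of_mem_closedBall {v : ℝ → ℝ} {a b : ℝ} (h : PowerType v a b) (ha : 0 ≤ a)
    (hb : 0 ≤ b) {α w : ℂ} (hα : α ∈ disc) (hw : w ∈ closedBall α ((1 - ‖α‖) / 10)) :
    v ‖α‖ ≤ 2 ^ (b + 1) * v ‖w‖ := by
  have h1 := one_sub_norm_bounds hw
  have h2 := mem_disc.1 hα
  refine h.le_of_comparable ha hb (norm_mem_Ico (closedBall_subset_disc hα hw)) (norm_mem_Ico hα)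
    ?_ ?_ <;> linarith

/-- Sums over a lattice are dominated by area integrals. -/
theorem IsLattice.sum_le_lintegral {u : Set ℂ} (hu : IsLattice u) {s : Finset ℂ}
    (hs : (s : Set ℂ) ⊆ u) {c g : ℂ → ℝ≥0∞}
    (hcg : ∀ a ∈ s, ∀ w ∈ closedBall a ((1 - ‖a‖) / 100), c a ≤ g w) :
    ∑ a ∈ s, ENNReal.ofReal ((1 - ‖a‖) ^ 2) * c a ≤ 10000 * ∫⁻ w in disc, g w := by
  have hvol : ∀ a ∈ s, ENNReal.ofReal ((1 - ‖a‖) ^ 2) ≤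
      10000 * volume (closedBall a ((1 - ‖a‖) / 100)) := by
    intro a ha
    have h1 : 0 < 1 - ‖a‖ := by linarith [mem_disc.1 (hu.subset_disc (hs ha))]
    rw [Complex.volume_closedBall, ← ENNReal.ofReal_pow (by positivity),
      ← ENNReal.ofReal_coe_nnreal, NNReal.coe_real_pi,
      ← ENNReal.ofReal_mul (by positivity), show (10000 : ℝ≥0∞) = ENNReal.ofReal 10000 by simp,
      ← ENNReal.ofReal_mul (by norm_num)]
    refine ENNReal.ofReal_le_ofReal ?_
    nlinarith [Real.pi_gt_three, sq_nonneg (1 - ‖a‖)]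
  calc ∑ a ∈ s, ENNReal.ofReal ((1 - ‖a‖) ^ 2) * c a
      ≤ ∑ a ∈ s, 10000 * ∫⁻ w in closedBall a ((1 - ‖a‖) / 100), g w := by
        refine Finset.sum_le_sum fun a ha => ?_
        calc _ ≤ 10000 * volume (closedBall a ((1 - ‖a‖) / 100)) * c a := by
              gcongr
              exact hvol a ha
          _ = 10000 * ∫⁻ w in closedBall a ((1 - ‖a‖) / 100), c a := by
              rw [setLIntegral_const]; ring
          _ ≤ _ := by
              gcongr 10000 * ?_
              exact setLIntegral_mono' measurableSet_closedBall (hcg a ha)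
    _ = 10000 * ∫⁻ w in ⋃ a ∈ s, closedBall a ((1 - ‖a‖) / 100), g w := by
        rw [← Finset.mul_sum, lintegral_biUnion_finset (hu.disjoint.subset hs)
          fun _ _ => measurableSet_closedBall]
    _ ≤ _ := by
        gcongr 10000 * ?_
        refine lintegral_mono_set (iUnion₂_subset fun a ha => ?_)
        have ha' := hu.subset_disc (hs ha)
        exact (closedBall_div_mono ha' (by norm_num) (by norm_num)).trans
          (closedBall_subset_disc ha')

/-- The enlarged discs of a lattice have bounded overlap. -/
theorem IsLattice.sum_indicator_le {u : Set ℂ} (hu : IsLattice u) {s : Finset ℂ}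
    (hs : (s : Set ℂ) ⊆ u) {w : ℂ} (hw : w ∈ disc) :
    ∑ a ∈ s, (closedBall a ((1 - ‖a‖) / 10)).indicator (1 : ℂ → ℝ≥0∞) w ≤ 100000 := by
  have hw1 : 0 < 1 - ‖w‖ := by linarith [mem_disc.1 hw]
  -- The sum is compared with the integral of the constant `K` over the disc of radius `1 - |w|`
  -- about `w`, which is `π ≤ 4`. If the enlarged disc of `a` contains `w`, the small disc of `a`
  -- lies in that disc, and `(1 - |a|) ^ 2 * K ≥ 1 / 2`.
  set K := ENNReal.ofReal (((1 - ‖w‖) ^ 2)⁻¹) with hK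
  have h := hu.sum_le_lintegral hs
    (c := fun a => K * (closedBall a ((1 - ‖a‖) / 10)).indicator (1 : ℂ → ℝ≥0∞) w)
    (g := (ball w (1 - ‖w‖)).indicator fun _ => K) ?_
  · have h1 : ∫⁻ z in disc, (ball w (1 - ‖w‖)).indicator (fun _ => K) z ≤ 4 := by
      refine (setLIntegral_le_lintegral _ _).trans ?_
      rw [lintegral_indicator measurableSet_ball, setLIntegral_const, Complex.volume_ball,
        ← ENNReal.ofReal_pow hw1.le, ← ENNReal.ofReal_coe_nnreal, NNReal.coe_real_pi, hK,
        ← ENNReal.ofReal_mul (by positivity), ← ENNReal.ofReal_mul (by positivity),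
        show (4 : ℝ≥0∞) = ENNReal.ofReal 4 by simp]
      refine ENNReal.ofReal_le_ofReal ?_
      rw [← mul_assoc, inv_mul_cancel₀ (by positivity), one_mul]
      exact Real.pi_lt_four.le
    have h2 : ∀ a ∈ s, (closedBall a ((1 - ‖a‖) / 10)).indicator (1 : ℂ → ℝ≥0∞) w ≤
        2 * (ENNReal.ofReal ((1 - ‖a‖) ^ 2) *
          (K * (closedBall a ((1 - ‖a‖) / 10)).indicator (1 : ℂ → ℝ≥0∞) w)) := by
      intro a ha
      by_cases hmem : w ∈ closedBall a ((1 - ‖a‖) / 10)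
      · simp only [indicator_of_mem hmem, Pi.one_apply, mul_one]
        rw [hK, ← ENNReal.ofReal_mul (by positivity), show (2 : ℝ≥0∞) = ENNReal.ofReal 2 by simp,
          ← ENNReal.ofReal_mul (by positivity), ← ENNReal.ofReal_one]
        refine ENNReal.ofReal_le_ofReal ?_
        have := (one_sub_norm_bounds hmem).1
        rw [← div_eq_mul_inv, mul_div_assoc', le_div_iff₀ (by positivity)]
        nlinarith
      · simp [indicator_of_notMem hmem]
    calc _ ≤ ∑ a ∈ s, 2 * (ENNReal.ofReal ((1 - ‖a‖) ^ 2) *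
          (K * (closedBall a ((1 - ‖a‖) / 10)).indicator (1 : ℂ → ℝ≥0∞) w)) :=
          Finset.sum_le_sum h2
      _ ≤ 2 * (10000 * 4) := by
          rw [← Finset.mul_sum]
          gcongr
          exact h.trans (by gcongr)
      _ ≤ 100000 := by norm_num
  · intro a ha z hz
    by_cases hmem : w ∈ closedBall a ((1 - ‖a‖) / 10)
    · have h1 := (one_sub_norm_bounds hmem).2
      have ha1 : 0 < 1 - ‖a‖ := by linarith [mem_disc.1 (hu.subset_disc (hs ha))]
      have hzb : z ∈ ball w (1 - ‖w‖) := by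
        rw [mem_closedBall] at hmem hz
        rw [mem_ball]
        have := dist_triangle_right z w a
        linarith
      simp [indicator_of_mem hmem, indicator_of_mem hzb]
    · simp [indicator_of_notMem hmem]

theorem norm_one_sub_conj_mul_comm (a z : ℂ) :
    ‖1 - (starRingEnd ℂ) a * z‖ = ‖1 - (starRingEnd ℂ) z * a‖ := by
  rw [← RCLike.norm_conj (1 - (starRingEnd ℂ) a * z)]
  simp [mul_comm]

theorem kernelNorm_nonneg {a : ℂ} (ha : a ∈ disc) (z : ℂ) : 0 ≤ kernelNorm a z :=
  div_nonneg (by linarith [mem_disc.1 ha]) (norm_nonneg _)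

/-- The discrete kernel estimate over a lattice. -/
theorem IsLattice.sum_kernelNorm_le {u : Set ℂ} (hu : IsLattice u) {ε M : ℝ} (hε : 0 < ε)
    (hM : 2 ≤ M) (hεM : ε + 1 < M) :
    ∃ C : ℝ≥0, ∀ s : Finset ℂ, (s : Set ℂ) ⊆ u → ∀ z ∈ disc,
      ∑ a ∈ s, ENNReal.ofReal ((1 - ‖a‖) ^ (-ε)) * ENNReal.ofReal (kernelNorm a z ^ M) ≤
        C * ENNReal.ofReal ((1 - ‖z‖) ^ (-ε)) := by
  -- The sum is compared with an area integral of the kernel based at `z`. Exchanging the roles of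
  -- `a` and `z` costs `(1 - |a|) ^ M (1 - |z|) ^ (-M)`; together with `(1 - |a|) ^ (-ε)` and the
  -- area factor this leaves the weight `(1 - |w|) ^ (M - ε - 2)`.
  have hv := powerType_one_sub_rpow (M - ε - 2)
  obtain ⟨C, hC⟩ := hv.lintegral_kernelNorm_le (by linarith) hM (by linarith)
  refine ⟨10000 * (Real.toNNReal (2 ^ M * 2 ^ (M - ε)) * C), fun s hs z hz => ?_⟩
  have hz1 : 0 < 1 - ‖z‖ := by linarith [mem_disc.1 hz]
  set K : ℝ := 2 ^ M * 2 ^ (M - ε) with hK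
  have h := hu.sum_le_lintegral hs
    (c := fun a => ENNReal.ofReal ((1 - ‖a‖) ^ (-ε - 2) * kernelNorm a z ^ M))
    (g := fun w => ENNReal.ofReal (K * (1 - ‖z‖) ^ (-M)) *
      (ENNReal.ofReal (kernelNorm z w ^ M) * ENNReal.ofReal ((1 - ‖w‖) ^ (M - ε - 2)))) ?_
  · calc ∑ a ∈ s, ENNReal.ofReal ((1 - ‖a‖) ^ (-ε)) * ENNReal.ofReal (kernelNorm a z ^ M)
        = ∑ a ∈ s, ENNReal.ofReal ((1 - ‖a‖) ^ 2) *
          ENNReal.ofReal ((1 - ‖a‖) ^ (-ε - 2) * kernelNorm a z ^ M) := by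
          refine Finset.sum_congr rfl fun a ha => ?_
          have ha1 : 0 < 1 - ‖a‖ := by linarith [mem_disc.1 (hu.subset_disc (hs ha))]
          rw [← ENNReal.ofReal_mul (by positivity), ← ENNReal.ofReal_mul (by positivity),
            ← mul_assoc, ← Real.rpow_two, ← Real.rpow_add ha1]
          congr 4
          ring
      _ ≤ _ := h
      _ = 10000 * (ENNReal.ofReal (K * (1 - ‖z‖) ^ (-M)) * ∫⁻ w in disc,
          ENNReal.ofReal (kernelNorm z w ^ M) * ENNReal.ofReal ((1 - ‖w‖) ^ (M - ε - 2))) := by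
          rw [lintegral_const_mul' _ _ ENNReal.ofReal_ne_top]
      _ ≤ 10000 * (ENNReal.ofReal (K * (1 - ‖z‖) ^ (-M)) * (C *
          ENNReal.ofReal ((1 - ‖z‖) ^ 2 * (1 - ‖z‖) ^ (M - ε - 2)))) := by
          gcongr 10000 * (_ * ?_)
          exact hC z hz
      _ = _ := by
          have e : (1 - ‖z‖) ^ (-M) * ((1 - ‖z‖) ^ 2 * (1 - ‖z‖) ^ (M - ε - 2)) =
              (1 - ‖z‖) ^ (-ε) := by
            rw [← Real.rpow_two, ← Real.rpow_add hz1, ← Real.rpow_add hz1]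
            congr 1
            ring
          rw [← e, ENNReal.ofReal_mul (by positivity), ENNReal.ofReal_mul (p := (1 - ‖z‖) ^ (-M))
            (by positivity)]
          push_cast
          rw [ENNReal.ofReal]
          ring
  · intro a ha w hw
    have had := hu.subset_disc (hs ha)
    have ha1 : 0 < 1 - ‖a‖ := by linarith [mem_disc.1 had]
    have hw10 := closedBall_div_mono had (by norm_num) (by norm_num : (10 : ℝ) ≤ 100) hw
    have hwd := closedBall_subset_disc had hw10
    have hw1 : 0 < 1 - ‖w‖ := by linarith [mem_disc.1 hwd]
    have hkz := kernelNorm_nonneg hz w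
    have h1 : 0 < ‖1 - (starRingEnd ℂ) a * z‖ ∧ 1 - ‖a‖ ≤ ‖1 - (starRingEnd ℂ) a * z‖ := by
      have := one_sub_mul_le_norm a z
      have h3 : ‖a‖ * ‖z‖ ≤ ‖a‖ := mul_le_of_le_one_right (norm_nonneg a) (mem_disc.1 hz).le
      constructor <;> linarith
    have h2 : 0 < ‖1 - (starRingEnd ℂ) z * w‖ :=
      norm_pos_iff.2 (one_sub_conj_mul_ne_zero (mem_disc.1 hz) (mem_disc.1 hwd))
    -- Moving `a` to `w` inside its small disc changes `1 - āz` by at most `(1 - |a|) / 100`, and `1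
    -- - |a|` is itself at most `|1 - āz|`.
    have h3 : ‖1 - (starRingEnd ℂ) z * w‖ ≤ 2 * ‖1 - (starRingEnd ℂ) a * z‖ := by
      rw [norm_one_sub_conj_mul_comm z w]
      have e : 1 - (starRingEnd ℂ) w * z = (1 - (starRingEnd ℂ) a * z) +
          (starRingEnd ℂ) (a - w) * z := by
        rw [map_sub]; ring
      have h4 : ‖(starRingEnd ℂ) (a - w) * z‖ ≤ (1 - ‖a‖) / 100 := by
        rw [norm_mul, RCLike.norm_conj, norm_sub_rev, ← dist_eq_norm]
        exact (mul_le_of_le_one_right dist_nonneg (mem_disc.1 hz).le).trans (mem_closedBall.1 hw)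
      rw [e]
      refine (norm_add_le _ _).trans ?_
      linarith [h1.2]
    have h5 : kernelNorm a z ≤ 2 * (1 - ‖a‖) * (1 - ‖z‖)⁻¹ * kernelNorm z w := by
      rw [kernelNorm, kernelNorm, div_le_iff₀ h1.1]
      have : (1 - ‖a‖) * 1 ≤ (1 - ‖a‖) *
          (2 * ‖1 - (starRingEnd ℂ) a * z‖ / ‖1 - (starRingEnd ℂ) z * w‖) := by
        gcongr
        rwa [le_div_iff₀ h2, one_mul]
      calc 1 - ‖a‖ = (1 - ‖a‖) * 1 := (mul_one _).symm
        _ ≤ _ := this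
        _ = _ := by field_simp
    have h6 : kernelNorm a z ^ M ≤ 2 ^ M * (1 - ‖a‖) ^ M * (1 - ‖z‖) ^ (-M) * kernelNorm z w ^ M := by
      calc kernelNorm a z ^ M ≤ (2 * (1 - ‖a‖) * (1 - ‖z‖)⁻¹ * kernelNorm z w) ^ M :=
            Real.rpow_le_rpow (kernelNorm_nonneg had z) h5 (by linarith)
        _ = _ := by
            rw [Real.mul_rpow (by positivity) hkz, Real.mul_rpow (by positivity) (by positivity),
              Real.mul_rpow (by positivity) (by positivity), Real.inv_rpow hz1.le,
              Real.rpow_neg hz1.le]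
    have h7 := hv.le_of_mem_closedBall (by linarith) (by linarith) had hw10
    rw [← ENNReal.ofReal_mul (by positivity), ← ENNReal.ofReal_mul (by positivity)]
    refine ENNReal.ofReal_le_ofReal ?_
    calc (1 - ‖a‖) ^ (-ε - 2) * kernelNorm a z ^ M
        ≤ (1 - ‖a‖) ^ (-ε - 2) * (2 ^ M * (1 - ‖a‖) ^ M * (1 - ‖z‖) ^ (-M) * kernelNorm z w ^ M) := by
          gcongr
      _ = 2 ^ M * (1 - ‖z‖) ^ (-M) * kernelNorm z w ^ M * (1 - ‖a‖) ^ (M - ε - 2) := by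
          rw [show M - ε - 2 = (-ε - 2) + M by ring, Real.rpow_add ha1]
          ring
      _ ≤ 2 ^ M * (1 - ‖z‖) ^ (-M) * kernelNorm z w ^ M *
          (2 ^ (M - ε - 2 + 1 + 1) * (1 - ‖w‖) ^ (M - ε - 2)) := by
          gcongr
      _ = _ := by
          rw [show M - ε - 2 + 1 + 1 = M - ε by ring, hK]
          ring

/-! ### Norm estimates for sums of kernels -/

section

/-- A linear combination of powers of normalized kernels. -/
def kernelSum (m : ℕ) (s : Finset ℂ) (c : ℂ → ℂ) (z : ℂ) : ℂ :=
  ∑ a ∈ s, c a * ((1 - ‖a‖ : ℝ) / (1 - (starRingEnd ℂ) a * z)) ^ m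

theorem differentiableOn_kernelSum {m : ℕ} {s : Finset ℂ} (hs : (s : Set ℂ) ⊆ disc) (c : ℂ → ℂ) :
    DifferentiableOn ℂ (kernelSum m s c) disc := by
  unfold kernelSum
  refine DifferentiableOn.fun_sum fun a ha => ?_
  intro z hz
  have h := one_sub_conj_mul_ne_zero (mem_disc.1 (hs ha)) (mem_disc.1 hz)
  have h1 : DifferentiableWithinAt ℂ (fun z => ((1 - ‖a‖ : ℝ) : ℂ) / (1 - (starRingEnd ℂ) a * z))
      disc z := DifferentiableWithinAt.div (by fun_prop) (by fun_prop) h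
  exact (h1.pow m).const_mul _

theorem norm_kernel_pow {a : ℂ} (ha : a ∈ disc) (z : ℂ) (m : ℕ) :
    ‖(((1 - ‖a‖ : ℝ) : ℂ) / (1 - (starRingEnd ℂ) a * z)) ^ m‖ = kernelNorm a z ^ (m : ℝ) := by
  have h1 : 0 ≤ 1 - ‖a‖ := by linarith [mem_disc.1 ha]
  rw [norm_pow, norm_div, Complex.norm_real, Real.norm_of_nonneg h1, Real.rpow_natCast, kernelNorm]

theorem enorm_kernelSum_le {m : ℕ} {s : Finset ℂ} (hs : (s : Set ℂ) ⊆ disc) (c : ℂ → ℂ) (z : ℂ) :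
    ‖kernelSum m s c z‖ₑ ≤ ∑ a ∈ s, ‖c a‖ₑ * ENNReal.ofReal (kernelNorm a z ^ (m : ℝ)) := by
  refine (enorm_sum_le _ _).trans (Finset.sum_le_sum fun a ha => ?_)
  rw [enorm_mul, ← ofReal_norm (_ ^ m), norm_kernel_pow (hs ha)]

theorem rpow_sum_le_sum_rpow {ι : Type*} (s : Finset ι) (x : ι → ℝ≥0∞) {p : ℝ} (hp : 0 < p)
    (hp1 : p ≤ 1) : (∑ i ∈ s, x i) ^ p ≤ ∑ i ∈ s, x i ^ p :=
  Finset.le_sum_of_subadditive (fun y : ℝ≥0∞ => y ^ p) (by simp [hp])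
    (fun y z => ENNReal.rpow_add_le_add_rpow y z hp.le hp1) s x

/-- Jensen's inequality for `x ^ p` with weights that are not normalized; it is the Hölder step of
the kernel estimate for `p ≥ 1`. -/
theorem rpow_sum_mul_le {ι : Type*} (s : Finset ι) (w f : ι → ℝ≥0∞) {p : ℝ} (hp : 1 ≤ p) :
    (∑ i ∈ s, w i * f i) ^ p ≤ (∑ i ∈ s, w i) ^ (p - 1) * ∑ i ∈ s, w i * f i ^ p := by
  have hp0 : 0 < p := by linarith
  refine (ENNReal.rpow_le_rpow (ENNReal.inner_le_weight_mul_Lp_of_nonneg s hp w f) hp0.le).trans ?_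
  rw [ENNReal.mul_rpow_of_nonneg _ _ hp0.le, ← ENNReal.rpow_mul, ← ENNReal.rpow_mul,
    inv_mul_cancel₀ hp0.ne', ENNReal.rpow_one, sub_mul, inv_mul_cancel₀ hp0.ne', one_mul]

variable {v : ℝ → ℝ} {a b : ℝ}

theorem PowerType.measurable_weight (h : PowerType v a b) :
    Measurable fun z : ℂ => ENNReal.ofReal (v ‖z‖) :=
  (h.measurable.comp measurable_norm).ennreal_ofReal

/-- For `p ≤ 1` subadditivity of `x ^ p` decouples the terms, and each is a kernel integral with
exponent `m p`; `m` is taken large enough for that estimate to apply. -/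
theorem PowerType.lintegral_kernelSum_le_of_le_one (h : PowerType v a b) (ha : 0 < a) {u : Set ℂ}
    (hu : IsLattice u) {p : ℝ} (hp : 0 < p) (hp1 : p ≤ 1) :
    ∃ (m : ℕ) (C : ℝ≥0), ∀ s : Finset ℂ, (s : Set ℂ) ⊆ u → ∀ c : ℂ → ℂ,
      ∫⁻ z in disc, ‖kernelSum m s c z‖ₑ ^ p * ENNReal.ofReal (v ‖z‖) ≤
        C * ∑ α ∈ s, ‖c α‖ₑ ^ p * ENNReal.ofReal ((1 - ‖α‖) ^ 2 * v ‖α‖) := by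
  obtain ⟨m, hm⟩ := exists_nat_gt ((|b| + 2) / p)
  have hmp : |b| + 2 < m * p := by rwa [div_lt_iff₀ hp] at hm
  obtain ⟨C, hC⟩ := h.lintegral_kernelNorm_le (M := m * p) ha (by linarith [abs_nonneg b])
    (by linarith [le_abs_self b])
  refine ⟨m, C, fun s hs c => ?_⟩
  have hsd := hs.trans hu.subset_disc
  calc ∫⁻ z in disc, ‖kernelSum m s c z‖ₑ ^ p * ENNReal.ofReal (v ‖z‖)
      ≤ ∫⁻ z in disc, ∑ α ∈ s, ‖c α‖ₑ ^ p *
          (ENNReal.ofReal (kernelNorm α z ^ (m * p)) * ENNReal.ofReal (v ‖z‖)) := by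
        refine lintegral_mono fun z => ?_
        calc _ ≤ (∑ α ∈ s, ‖c α‖ₑ * ENNReal.ofReal (kernelNorm α z ^ (m : ℝ))) ^ p *
              ENNReal.ofReal (v ‖z‖) := by
              gcongr
              exact enorm_kernelSum_le hsd c z
          _ ≤ (∑ α ∈ s, (‖c α‖ₑ * ENNReal.ofReal (kernelNorm α z ^ (m : ℝ))) ^ p) *
              ENNReal.ofReal (v ‖z‖) := by
              gcongr
              exact rpow_sum_le_sum_rpow s _ hp hp1
          _ = _ := by
              rw [Finset.sum_mul]
              refine Finset.sum_congr rfl fun α hα => ?_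
              have hk := kernelNorm_nonneg (hsd hα) z
              rw [ENNReal.mul_rpow_of_nonneg _ _ hp.le, ENNReal.ofReal_rpow_of_nonneg
                (Real.rpow_nonneg hk _) hp.le, ← Real.rpow_mul hk, mul_assoc]
    _ = ∑ α ∈ s, ‖c α‖ₑ ^ p * ∫⁻ z in disc,
          ENNReal.ofReal (kernelNorm α z ^ (m * p)) * ENNReal.ofReal (v ‖z‖) := by
        have hmeas : ∀ α, Measurable fun z =>
            ENNReal.ofReal (kernelNorm α z ^ (m * p)) * ENNReal.ofReal (v ‖z‖) := fun α =>
          ((measurable_kernelNorm α).pow_const _).ennreal_ofReal.mul h.measurable_weight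
        rw [lintegral_finsetSum _ fun α _ => (hmeas α).const_mul _]
        exact Finset.sum_congr rfl fun α _ => lintegral_const_mul _ (hmeas α)
    _ ≤ ∑ α ∈ s, ‖c α‖ₑ ^ p * (C * ENNReal.ofReal ((1 - ‖α‖) ^ 2 * v ‖α‖)) := by
        gcongr with α hα
        exact hC α (hsd hα)
    _ = _ := by
        rw [Finset.mul_sum]
        exact Finset.sum_congr rfl fun α _ => by ring

/-- A Schur test: Hölder with the weights `(1 - |α|) ^ (-δ)` times the kernel, whose sum over the
lattice is at most a multiple of `(1 - |z|) ^ (-δ)`. Its power `p - 1` is absorbed into the weight,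
which remains of power type with positive lower exponent, and the kernel estimate is applied term by
term. -/
theorem PowerType.lintegral_kernelSum_le_of_one_le (h : PowerType v a b) (ha : 0 < a) {u : Set ℂ}
    (hu : IsLattice u) {p : ℝ} (hp1 : 1 ≤ p) :
    ∃ (m : ℕ) (C : ℝ≥0), ∀ s : Finset ℂ, (s : Set ℂ) ⊆ u → ∀ c : ℂ → ℂ,
      ∫⁻ z in disc, ‖kernelSum m s c z‖ₑ ^ p * ENNReal.ofReal (v ‖z‖) ≤
        C * ∑ α ∈ s, ‖c α‖ₑ ^ p * ENNReal.ofReal ((1 - ‖α‖) ^ 2 * v ‖α‖) := by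
  have hp : 0 < p := by linarith
  -- Any `δ > 0` with `δ (p - 1) < a` would do: this keeps the modified weight `(1 - r) ^ (-(δ (p -
  -- 1))) v` integrable at the boundary.
  set δ : ℝ := a / p with hδ
  have hδ0 : 0 < δ := by positivity
  have hδa : δ * (p - 1) < a := by
    rw [mul_sub, hδ, div_mul_cancel₀ _ hp.ne', mul_one]
    linarith
  have hδp : 0 ≤ δ * (p - 1) := mul_nonneg hδ0.le (by linarith)
  obtain ⟨m, hm⟩ := exists_nat_gt (|b| + δ + 2)
  have hb := le_abs_self b
  have hb' := abs_nonneg b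
  have hv := h.one_sub_rpow_mul (-(δ * (p - 1)))
  obtain ⟨C, hC⟩ := hv.lintegral_kernelNorm_le (M := m) (by linarith) (by linarith) (by linarith)
  obtain ⟨D, hD⟩ := hu.sum_kernelNorm_le (M := m) hδ0 (by linarith) (by linarith)
  refine ⟨m, D ^ (p - 1) * C, fun s hs c => ?_⟩
  have hsd := hs.trans hu.subset_disc
  have hpt : ∀ z ∈ disc, ‖kernelSum m s c z‖ₑ ^ p * ENNReal.ofReal (v ‖z‖) ≤
      ∑ α ∈ s, (D : ℝ≥0∞) ^ (p - 1) * (‖c α‖ₑ ^ p * ENNReal.ofReal ((1 - ‖α‖) ^ (δ * (p - 1)))) *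
        (ENNReal.ofReal (kernelNorm α z ^ (m : ℝ)) *
          ENNReal.ofReal ((1 - ‖z‖) ^ (-(δ * (p - 1))) * v ‖z‖)) := by
    intro z hz
    have hz1 : 0 < 1 - ‖z‖ := by linarith [mem_disc.1 hz]
    have e1 : ‖kernelSum m s c z‖ₑ ≤ ∑ α ∈ s, (ENNReal.ofReal ((1 - ‖α‖) ^ (-δ)) *
        ENNReal.ofReal (kernelNorm α z ^ (m : ℝ))) * (‖c α‖ₑ * ENNReal.ofReal ((1 - ‖α‖) ^ δ)) := by
      refine (enorm_kernelSum_le hsd c z).trans (le_of_eq (Finset.sum_congr rfl fun α hα => ?_))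
      have hα1 : 0 < 1 - ‖α‖ := by linarith [mem_disc.1 (hsd hα)]
      have : ENNReal.ofReal ((1 - ‖α‖) ^ (-δ)) * ENNReal.ofReal ((1 - ‖α‖) ^ δ) = 1 := by
        rw [← ENNReal.ofReal_mul (by positivity), ← Real.rpow_add hα1]
        simp
      calc ‖c α‖ₑ * ENNReal.ofReal (kernelNorm α z ^ (m : ℝ))
          = ‖c α‖ₑ * ENNReal.ofReal (kernelNorm α z ^ (m : ℝ)) *
            (ENNReal.ofReal ((1 - ‖α‖) ^ (-δ)) * ENNReal.ofReal ((1 - ‖α‖) ^ δ)) := by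
              rw [this, mul_one]
        _ = _ := by ring
    calc _ ≤ ((D * ENNReal.ofReal ((1 - ‖z‖) ^ (-δ))) ^ (p - 1) *
          ∑ α ∈ s, (ENNReal.ofReal ((1 - ‖α‖) ^ (-δ)) *
            ENNReal.ofReal (kernelNorm α z ^ (m : ℝ))) *
              (‖c α‖ₑ * ENNReal.ofReal ((1 - ‖α‖) ^ δ)) ^ p) * ENNReal.ofReal (v ‖z‖) := by
          gcongr
          refine (ENNReal.rpow_le_rpow e1 hp.le).trans ((rpow_sum_mul_le s _ _ hp1).trans ?_)
          gcongr
          exact hD s hs z hz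
      _ = _ := by
          rw [Finset.mul_sum, Finset.sum_mul]
          refine Finset.sum_congr rfl fun α hα => ?_
          have hα1 : 0 < 1 - ‖α‖ := by linarith [mem_disc.1 (hsd hα)]
          have e2 : ENNReal.ofReal ((1 - ‖α‖) ^ (δ * (p - 1))) =
              ENNReal.ofReal ((1 - ‖α‖) ^ (-δ)) * ENNReal.ofReal ((1 - ‖α‖) ^ δ) ^ p := by
            rw [ENNReal.ofReal_rpow_of_pos (by positivity), ← Real.rpow_mul hα1.le,
              ← ENNReal.ofReal_mul (by positivity), ← Real.rpow_add hα1]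
            congr 2
            ring
          have e3 : ENNReal.ofReal ((1 - ‖z‖) ^ (-(δ * (p - 1))) * v ‖z‖) =
              ENNReal.ofReal ((1 - ‖z‖) ^ (-δ)) ^ (p - 1) * ENNReal.ofReal (v ‖z‖) := by
            rw [ENNReal.ofReal_rpow_of_pos (by positivity), ← Real.rpow_mul hz1.le,
              ← ENNReal.ofReal_mul (by positivity), neg_mul]
          rw [e2, e3, ENNReal.mul_rpow_of_nonneg _ _ hp.le,
            ENNReal.mul_rpow_of_nonneg _ _ (by linarith : 0 ≤ p - 1)]
          ring
  have hmeas : ∀ α, Measurable fun z : ℂ => ENNReal.ofReal (kernelNorm α z ^ (m : ℝ)) *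
      ENNReal.ofReal ((1 - ‖z‖) ^ (-(δ * (p - 1))) * v ‖z‖) := fun α =>
    ((measurable_kernelNorm α).pow_const _).ennreal_ofReal.mul hv.measurable_weight
  refine (setLIntegral_mono' measurableSet_disc hpt).trans ?_
  rw [lintegral_finsetSum _ fun α _ => (hmeas α).const_mul _, Finset.mul_sum]
  refine Finset.sum_le_sum fun α hα => ?_
  rw [lintegral_const_mul _ (hmeas α)]
  have hα1 : 0 < 1 - ‖α‖ := by linarith [mem_disc.1 (hsd hα)]
  calc _ ≤ (D : ℝ≥0∞) ^ (p - 1) * (‖c α‖ₑ ^ p * ENNReal.ofReal ((1 - ‖α‖) ^ (δ * (p - 1)))) *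
        (C * ENNReal.ofReal ((1 - ‖α‖) ^ 2 * ((1 - ‖α‖) ^ (-(δ * (p - 1))) * v ‖α‖))) := by
        gcongr _ * ?_
        exact hC α (hsd hα)
    _ = _ := by
        have e4 : ENNReal.ofReal ((1 - ‖α‖) ^ (δ * (p - 1))) *
            ENNReal.ofReal ((1 - ‖α‖) ^ 2 * ((1 - ‖α‖) ^ (-(δ * (p - 1))) * v ‖α‖)) =
            ENNReal.ofReal ((1 - ‖α‖) ^ 2 * v ‖α‖) := by
          rw [← ENNReal.ofReal_mul (by positivity), Real.rpow_neg hα1.le]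
          congr 1
          field_simp
        rw [← e4]
        push_cast
        rw [ENNReal.coe_rpow_of_nonneg _ (by linarith : 0 ≤ p - 1)]
        ring

/-- The norm estimate for kernel sums over a lattice. -/
theorem PowerType.lintegral_kernelSum_le (h : PowerType v a b) (ha : 0 < a) {u : Set ℂ}
    (hu : IsLattice u) {p : ℝ} (hp : 0 < p) :
    ∃ (m : ℕ) (C : ℝ≥0), ∀ s : Finset ℂ, (s : Set ℂ) ⊆ u → ∀ c : ℂ → ℂ,
      ∫⁻ z in disc, ‖kernelSum m s c z‖ₑ ^ p * ENNReal.ofReal (v ‖z‖) ≤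
        C * ∑ α ∈ s, ‖c α‖ₑ ^ p * ENNReal.ofReal ((1 - ‖α‖) ^ 2 * v ‖α‖) := by
  rcases le_total p 1 with hp1 | hp1
  · exact h.lintegral_kernelSum_le_of_le_one ha hu hp hp1
  · exact h.lintegral_kernelSum_le_of_one_le ha hu hp1

end

/-! ### Random signs, test functions and the discrete inequality -/

/-- Averaging over signs recovers every single term of a sum. -/
theorem card_mul_enorm_rpow_le_sum_signs {κ : Type*} [Fintype κ] [DecidableEq κ] (x : κ → ℂ) {q : ℝ}
    (hq : 0 < q) (k : κ) :
    (Fintype.card (κ → ℤˣ) : ℝ≥0∞) * ‖x k‖ₑ ^ q ≤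
      2 * ∑ ε : κ → ℤˣ, ‖∑ j, ((ε j : ℤ) : ℂ) * x j‖ₑ ^ q := by
  set S : (κ → ℤˣ) → ℂ := fun ε => ∑ j, ((ε j : ℤ) : ℂ) * x j with hS
  set g : κ → ℤˣ := Pi.mulSingle k (-1) with hg
  -- Flipping only the sign of index `k` changes the sum by `2 x k` up to sign, so one of the two
  -- sums has modulus at least `|x k|`; as the flip permutes all sign patterns, no Khinchine
  -- inequality is needed.
  have hflip : ∀ ε, S ε - S (g * ε) = 2 * (((ε k : ℤ) : ℂ) * x k) := by
    intro ε
    rw [hS]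
    simp only [← Finset.sum_sub_distrib]
    rw [Finset.sum_eq_single k]
    · simp [hg]
      ring
    · intro j _ hj
      simp [hg, Pi.mulSingle_eq_of_ne hj]
    · simp
  have hunit : ∀ e : ℤˣ, ‖((e : ℤ) : ℂ)‖ = 1 := by
    intro e
    rcases Int.units_eq_one_or e with h | h <;> simp [h]
  have hpair : ∀ ε, ‖x k‖ₑ ^ q ≤ ‖S ε‖ₑ ^ q + ‖S (g * ε)‖ₑ ^ q := by
    intro ε
    have h1 : 2 * ‖x k‖ ≤ ‖S ε‖ + ‖S (g * ε)‖ := by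
      have := norm_sub_le (S ε) (S (g * ε))
      rwa [hflip, norm_mul, norm_mul, hunit, one_mul, Complex.norm_ofNat] at this
    have mono : ∀ y : ℂ, ‖x k‖ ≤ ‖y‖ → ‖x k‖ₑ ^ q ≤ ‖y‖ₑ ^ q := fun y hy =>
      ENNReal.rpow_le_rpow (enorm_le_iff_norm_le.2 hy) hq.le
    rcases le_total ‖x k‖ ‖S ε‖ with h | h
    · exact (mono _ h).trans le_self_add
    · exact (mono (S (g * ε)) (by linarith)).trans le_add_self
  have hinv : ∑ ε, ‖S (g * ε)‖ₑ ^ q = ∑ ε, ‖S ε‖ₑ ^ q :=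
    Equiv.sum_comp (Equiv.mulLeft g) fun ε => ‖S ε‖ₑ ^ q
  calc (Fintype.card (κ → ℤˣ) : ℝ≥0∞) * ‖x k‖ₑ ^ q = ∑ _ε : κ → ℤˣ, ‖x k‖ₑ ^ q := by
        rw [Finset.sum_const, nsmul_eq_mul, Finset.card_univ]
    _ ≤ ∑ ε, (‖S ε‖ₑ ^ q + ‖S (g * ε)‖ₑ ^ q) := Finset.sum_le_sum fun ε _ => hpair ε
    _ = _ := by rw [Finset.sum_add_distrib, hinv, two_mul]

/-- Hölder's inequality for finite families of finite sums. -/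
theorem sum_prod_rpow_le {ι κ : Type*} [Fintype ι] (s : Finset κ) (X : ι → κ → ℝ≥0∞) {θ : ι → ℝ}
    (hθ : ∑ i, θ i = 1) (hθ0 : ∀ i, 0 ≤ θ i) :
    ∑ a ∈ s, ∏ i, X i a ^ θ i ≤ ∏ i, (∑ a ∈ s, X i a) ^ θ i := by
  let _ : MeasurableSpace s := ⊤
  have h := ENNReal.lintegral_prod_norm_pow_le (μ := (Measure.count : Measure s)) Finset.univ
    (f := fun i a => X i a) (fun i _ => (measurable_from_top).aemeasurable) hθ (fun i _ => hθ0 i)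
  simp only [lintegral_count, tsum_fintype] at h
  rw [← Finset.sum_coe_sort]
  simp_rw [← Finset.sum_coe_sort s (fun a => X _ a)]
  exact h

/-- The area of a small hyperbolic disc around `a`, weighted by `v`, up to a constant factor. -/
def cellWeight (v : ℝ → ℝ) (a : ℂ) : ℝ≥0∞ := ENNReal.ofReal ((1 - ‖a‖) ^ 2 * v ‖a‖)

/-- The integral `∫_𝔻 |f|^p v dxdy`. -/
def weightedIntegral (p : ℝ) (v : ℝ → ℝ) (f : ℂ → ℂ) : ℝ≥0∞ :=
  ∫⁻ z in disc, ‖f z‖ₑ ^ p * ENNReal.ofReal (v ‖z‖)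

/-- The multilinear Carleson inequality with constant `M`. -/
def MultiBound {ι : Type*} [Fintype ι] (p q : ι → ℝ) (v : ι → ℝ → ℝ) (μ : Measure ℂ)
    (M : ℝ≥0∞) : Prop :=
  ∀ f : ι → ℂ → ℂ, (∀ i, DifferentiableOn ℂ (f i) disc) →
    (∀ i, weightedIntegral (p i) (v i) (f i) < ∞) →
      ∫⁻ z in disc, ∏ i, ‖f i z‖ₑ ^ q i ∂μ ≤
        M * ∏ i, weightedIntegral (p i) (v i) (f i) ^ (q i / p i)

/-- The discrete form of the Carleson inequality over a lattice `u`. -/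
def SeqBound (u : Set ℂ) (l : ℝ) (W : ℂ → ℝ≥0∞) (μ : Measure ℂ) (N : ℝ≥0∞) : Prop :=
  ∀ s : Finset ℂ, (s : Set ℂ) ⊆ u → ∀ y : ℂ → ℝ≥0,
    ∑ a ∈ s, μ (closedBall a ((1 - ‖a‖) / 20)) * ((y a : ℝ≥0∞) ^ l / W a) ≤
      N * (∑ a ∈ s, (y a : ℝ≥0∞)) ^ l

theorem PowerType.cellWeight_ne_zero {v : ℝ → ℝ} {a b : ℝ} (h : PowerType v a b) {α : ℂ}
    (hα : α ∈ disc) : cellWeight v α ≠ 0 := by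
  have h1 : 0 < 1 - ‖α‖ := by linarith [mem_disc.1 hα]
  have h2 := h.pos _ (norm_mem_Ico hα)
  rw [cellWeight, Ne, ENNReal.ofReal_eq_zero, not_le]
  positivity

theorem cellWeight_ne_top (v : ℝ → ℝ) (α : ℂ) : cellWeight v α ≠ ∞ := ENNReal.ofReal_ne_top

/-- By the identity `1 - āz = (1 - |a|²) + ā (a - z)`, the denominator is at most `3 (1 - |a|)` on
the cell of `a`. -/
theorem one_third_le_kernelNorm {a z : ℂ} (ha : a ∈ disc)
    (hz : z ∈ closedBall a ((1 - ‖a‖) / 20)) : 1 / 3 ≤ kernelNorm a z := by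
  have ha1 := mem_disc.1 ha
  have hz' := closedBall_subset_disc ha (closedBall_div_mono ha (by norm_num) (by norm_num) hz)
  have hpos := norm_pos_iff.2 (one_sub_conj_mul_ne_zero ha1 (mem_disc.1 hz'))
  rw [kernelNorm, div_le_div_iff₀ (by norm_num) hpos]
  have e : 1 - (starRingEnd ℂ) a * z = ((1 - ‖a‖ ^ 2 : ℝ) : ℂ) + (starRingEnd ℂ) a * (a - z) := by
    have : (starRingEnd ℂ) a * a = ((‖a‖ ^ 2 : ℝ) : ℂ) := by
      rw [mul_comm, Complex.mul_conj, Complex.normSq_eq_norm_sq]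
    push_cast at this ⊢
    rw [mul_sub, this]
    ring
  have h0 := norm_nonneg a
  have h1 : ‖(starRingEnd ℂ) a * (a - z)‖ ≤ (1 - ‖a‖) / 20 := by
    rw [norm_mul, RCLike.norm_conj, norm_sub_rev, ← dist_eq_norm]
    exact (mul_le_of_le_one_left dist_nonneg ha1.le).trans (mem_closedBall.1 hz)
  have h2 : ‖((1 - ‖a‖ ^ 2 : ℝ) : ℂ)‖ = 1 - ‖a‖ ^ 2 := by
    rw [Complex.norm_real, Real.norm_of_nonneg (by nlinarith)]
  have h3 := norm_add_le ((1 - ‖a‖ ^ 2 : ℝ) : ℂ) ((starRingEnd ℂ) a * (a - z))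
  rw [e]
  rw [h2] at h3
  nlinarith

/-- Test functions with random signs: bounded norm, and on average at least as large on each cell as
prescribed. -/
theorem PowerType.exists_signed_kernelSum {v : ℝ → ℝ} {a b : ℝ} (h : PowerType v a b) (ha : 0 < a)
    {u : Set ℂ} (hu : IsLattice u) {p q : ℝ} (hp : 0 < p) (hq : 0 < q) :
    ∃ C : ℝ≥0, ∃ D : ℝ≥0, ∀ s : Finset ℂ, (s : Set ℂ) ⊆ u → ∀ y : ℂ → ℝ≥0,
      ∃ F : (s → ℤˣ) → ℂ → ℂ, (∀ ε, DifferentiableOn ℂ (F ε) disc) ∧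
        (∀ ε, weightedIntegral p v (F ε) ≤ C * ∑ α ∈ s, (y α : ℝ≥0∞)) ∧
        ∀ α ∈ s, ∀ z ∈ closedBall α ((1 - ‖α‖) / 20),
          (Fintype.card (s → ℤˣ) : ℝ≥0∞) * ((y α : ℝ≥0∞) / cellWeight v α) ^ (q / p) ≤
            D * ∑ ε, ‖F ε z‖ₑ ^ q := by
  classical
  obtain ⟨m, C, hC⟩ := h.lintegral_kernelSum_le ha hu hp
  refine ⟨C, 2 * ((3 : ℝ≥0) ^ m) ^ q, fun s hs y => ?_⟩
  have hsd := hs.trans hu.subset_disc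
  -- The coefficients are chosen with `|c α| ^ p * cellWeight v α = y α`, so the norm estimate gives
  -- exactly `∑ y`.
  set T : ℂ → ℝ≥0∞ := fun α => ((y α : ℝ≥0∞) / cellWeight v α) ^ p⁻¹ with hT
  have hTt : ∀ α ∈ s, T α ≠ ∞ := fun α hα => ENNReal.rpow_ne_top_of_nonneg (by positivity)
    (ENNReal.div_ne_top ENNReal.coe_ne_top (h.cellWeight_ne_zero (hsd hα)))
  set c : (s → ℤˣ) → ℂ → ℂ := fun ε α =>
    if hα : α ∈ s then ((ε ⟨α, hα⟩ : ℤ) : ℂ) * ((T α).toReal : ℂ) else 0 with hc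
  have hreal : ∀ α ∈ s, ‖(((T α).toReal : ℝ) : ℂ)‖ₑ = T α := by
    intro α hα
    rw [← ofReal_norm, Complex.norm_real, Real.norm_of_nonneg ENNReal.toReal_nonneg,
      ENNReal.ofReal_toReal (hTt α hα)]
  have hcn : ∀ ε, ∀ α ∈ s, ‖c ε α‖ₑ = T α := by
    intro ε α hα
    simp only [hc, hα, dif_pos]
    rcases Int.units_eq_one_or (ε ⟨α, hα⟩) with h | h <;> simp [h, hreal α hα]
  refine ⟨fun ε => kernelSum m s (c ε), fun ε => differentiableOn_kernelSum hsd _, fun ε => ?_, ?_⟩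
  · refine (hC s hs (c ε)).trans ?_
    gcongr with α hα
    rw [hcn ε α hα, hT]
    simp only
    rw [← ENNReal.rpow_mul, inv_mul_cancel₀ hp.ne', ENNReal.rpow_one]
    exact (ENNReal.div_mul_cancel (h.cellWeight_ne_zero (hsd hα)) (cellWeight_ne_top v α)).le
  · intro α hα z hz
    set x : s → ℂ := fun β => ((T β).toReal : ℂ) *
      (((1 - ‖(β : ℂ)‖ : ℝ) : ℂ) / (1 - (starRingEnd ℂ) (β : ℂ) * z)) ^ m with hx
    have hsum : ∀ ε, kernelSum m s (c ε) z = ∑ β : s, ((ε β : ℤ) : ℂ) * x β := by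
      intro ε
      rw [kernelSum, ← Finset.sum_coe_sort]
      refine Finset.sum_congr rfl fun β _ => ?_
      simp only [hc, hx, β.2, dif_pos, mul_assoc]
    have hsigns := card_mul_enorm_rpow_le_sum_signs x hq ⟨α, hα⟩
    simp_rw [hsum]
    have hlow : T α ≤ (3 : ℝ≥0∞) ^ m * ‖x ⟨α, hα⟩‖ₑ := by
      have hk := one_third_le_kernelNorm (hsd hα) hz
      rw [hx]
      simp only
      rw [enorm_mul, hreal α hα, ← ofReal_norm (_ ^ m), norm_kernel_pow (hsd hα),
        Real.rpow_natCast]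
      have : (1 : ℝ≥0∞) ≤ 3 ^ m * ENNReal.ofReal (kernelNorm α z ^ m) := by
        rw [show (3 : ℝ≥0∞) = ENNReal.ofReal 3 by simp, ← ENNReal.ofReal_pow (by norm_num),
          ← ENNReal.ofReal_mul (by positivity), ← mul_pow, ← ENNReal.ofReal_one]
        exact ENNReal.ofReal_le_ofReal (one_le_pow₀ (by linarith))
      calc T α = T α * 1 := (mul_one _).symm
        _ ≤ T α * (3 ^ m * ENNReal.ofReal (kernelNorm α z ^ m)) := by gcongr
        _ = _ := by ring
    have hTq : ((y α : ℝ≥0∞) / cellWeight v α) ^ (q / p) = T α ^ q := by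
      rw [hT]
      simp only
      rw [← ENNReal.rpow_mul, div_eq_inv_mul]
    calc (Fintype.card (s → ℤˣ) : ℝ≥0∞) * ((y α : ℝ≥0∞) / cellWeight v α) ^ (q / p)
        ≤ (Fintype.card (s → ℤˣ) : ℝ≥0∞) * ((3 : ℝ≥0∞) ^ m * ‖x ⟨α, hα⟩‖ₑ) ^ q := by
          rw [hTq]
          gcongr
      _ = ((3 : ℝ≥0∞) ^ m) ^ q * ((Fintype.card (s → ℤˣ) : ℝ≥0∞) * ‖x ⟨α, hα⟩‖ₑ ^ q) := by
          rw [ENNReal.mul_rpow_of_nonneg _ _ hq.le]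
          ring
      _ ≤ ((3 : ℝ≥0∞) ^ m) ^ q * (2 * ∑ ε : s → ℤˣ, ‖∑ β, ((ε β : ℤ) : ℂ) * x β‖ₑ ^ q) := by
          gcongr
      _ = _ := by
          push_cast
          rw [ENNReal.coe_rpow_of_nonneg _ hq.le]
          push_cast
          ring

/-! ### Equivalence of the multilinear and the discrete inequality -/

section

variable {ι : Type*} [Fintype ι] {p q : ι → ℝ} {v : ι → ℝ → ℝ} {a b : ι → ℝ} {u : Set ℂ}

theorem prod_div_rpow_eq (hpq : ∀ i, 0 ≤ q i / p i) (x : ℝ≥0∞) (w : ι → ℝ≥0∞)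
    (hw : ∀ i, w i ≠ 0) (hw' : ∀ i, w i ≠ ∞) :
    ∏ i, (x / w i) ^ (q i / p i) = x ^ (∑ i, q i / p i) / ∏ i, w i ^ (q i / p i) := by
  have h1 : ∏ i, x ^ (q i / p i) = x ^ (∑ i, q i / p i) := by
    classical
    induction (Finset.univ : Finset ι) using Finset.induction with
    | empty => simp
    | insert i s hi ih =>
      rw [Finset.prod_insert hi, Finset.sum_insert hi, ih,
        ENNReal.rpow_add_of_nonneg _ _ (hpq i) (Finset.sum_nonneg fun j _ => hpq j)]
  rw [← h1, div_eq_mul_inv, ENNReal.prod_inv_distrib, ← Finset.prod_mul_distrib]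
  · refine Finset.prod_congr rfl fun i _ => ?_
    rw [ENNReal.div_rpow_of_nonneg _ _ (hpq i), div_eq_mul_inv]
  · intro i _ j _ _
    exact Or.inl (by simp [hw i, hw' i])

theorem aemeasurable_prod_enorm_rpow {f : ι → ℂ → ℂ} (hf : ∀ i, DifferentiableOn ℂ (f i) disc)
    (μ : Measure ℂ) (q : ι → ℝ) :
    AEMeasurable (fun z => ∏ i, ‖f i z‖ₑ ^ q i) (μ.restrict disc) :=
  Finset.aemeasurable_fun_prod _ fun i _ =>
    ((hf i).continuousOn.aemeasurable measurableSet_disc).enorm.pow_const _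

/-- The multilinear Carleson inequality implies the discrete one. -/
theorem MultiBound.seqBound (hv : ∀ i, PowerType (v i) (a i) (b i)) (ha : ∀ i, 0 < a i)
    (hp : ∀ i, 0 < p i) (hq : ∀ i, 0 < q i) (hu : IsLattice u) :
    ∃ C : ℝ≥0, ∀ (μ : Measure ℂ) (M : ℝ≥0∞), MultiBound p q v μ M →
      SeqBound u (∑ i, q i / p i) (fun α => ∏ i, cellWeight (v i) α ^ (q i / p i)) μ (C * M) := by
  classical
  have hpq : ∀ i, 0 ≤ q i / p i := fun i => (div_pos (hq i) (hp i)).le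
  choose C D hCD using fun i => (hv i).exists_signed_kernelSum (ha i) hu (hp i) (hq i)
  refine ⟨100000 * (∏ i, D i) * ∏ i, C i ^ (q i / p i), fun μ M hM s hs y => ?_⟩
  have hsd := hs.trans hu.subset_disc
  choose F hFd hFn hFl using fun i => hCD i s hs y
  set κ : ℝ≥0∞ := (Fintype.card (s → ℤˣ) : ℝ≥0∞) ^ Fintype.card ι with hκ
  have hκ0 : κ ≠ 0 := pow_ne_zero _ (by simp)
  have hκt : κ ≠ ∞ := ENNReal.pow_ne_top (by simp)
  set l := ∑ i, q i / p i with hl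
  set Y : ℝ≥0∞ := ∑ α ∈ s, (y α : ℝ≥0∞) with hY
  have hYt : Y ≠ ∞ := by simp [hY]
  set X : ℂ → ℝ≥0∞ := fun α => (y α : ℝ≥0∞) ^ l / ∏ i, cellWeight (v i) α ^ (q i / p i) with hX
  -- The signs are chosen independently for each index, so the sum over all tuples of sign patterns
  -- factors into a product of sums, to which the averaging bound applies factor by factor. `κ` is
  -- the number of tuples and cancels at the end.
  set H : ℂ → ℝ≥0∞ := fun z => ∑ E : ι → s → ℤˣ, ∏ i, ‖F i (E i) z‖ₑ ^ q i with hH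
  have hHprod : ∀ z, H z = ∏ i, ∑ ε : s → ℤˣ, ‖F i ε z‖ₑ ^ q i := by
    intro z
    rw [hH, Finset.prod_univ_sum, Fintype.piFinset_univ]
  have hcell : ∀ α ∈ s, ∀ z ∈ closedBall α ((1 - ‖α‖) / 20), κ * X α ≤ (∏ i, (D i : ℝ≥0∞)) * H z := by
    intro α hα z hz
    rw [hX]
    simp only
    rw [← prod_div_rpow_eq hpq (y α : ℝ≥0∞) (fun i => cellWeight (v i) α)
      (fun i => (hv i).cellWeight_ne_zero (hsd hα)) (fun i => cellWeight_ne_top _ _), hHprod,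
      ← Finset.prod_mul_distrib, hκ, ← Finset.card_univ (α := ι), ← Finset.prod_const,
      ← Finset.prod_mul_distrib]
    exact Finset.prod_le_prod' fun i _ => hFl i α hα z hz
  have hsum : ∀ z ∈ disc, ∑ α ∈ s, (closedBall α ((1 - ‖α‖) / 20)).indicator (fun _ => κ * X α) z ≤
      100000 * ((∏ i, (D i : ℝ≥0∞)) * H z) := by
    intro z hz
    calc _ ≤ ∑ α ∈ s, (closedBall α ((1 - ‖α‖) / 10)).indicator (1 : ℂ → ℝ≥0∞) z *
          ((∏ i, (D i : ℝ≥0∞)) * H z) := by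
          refine Finset.sum_le_sum fun α hα => ?_
          by_cases hmem : z ∈ closedBall α ((1 - ‖α‖) / 20)
          · rw [indicator_of_mem hmem, indicator_of_mem
              (closedBall_div_mono (hsd hα) (by norm_num) (by norm_num) hmem), Pi.one_apply, one_mul]
            exact hcell α hα z hmem
          · rw [indicator_of_notMem hmem]
            exact zero_le
      _ ≤ _ := by
          rw [← Finset.sum_mul]
          gcongr
          exact hu.sum_indicator_le hs hz
  have hintegral : ∫⁻ z in disc, H z ∂μ ≤
      κ * (M * ((∏ i, (C i : ℝ≥0∞) ^ (q i / p i)) * Y ^ l)) := by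
    rw [hH, lintegral_finsetSum' _ fun E _ =>
      aemeasurable_prod_enorm_rpow (fun i => hFd i (E i)) μ q]
    calc _ ≤ ∑ E : ι → s → ℤˣ, M * ((∏ i, (C i : ℝ≥0∞) ^ (q i / p i)) * Y ^ l) := by
          refine Finset.sum_le_sum fun E _ => ?_
          refine (hM (fun i => F i (E i)) (fun i => hFd i (E i)) fun i =>
            (hFn i (E i)).trans_lt (ENNReal.mul_lt_top (by simp) hYt.lt_top)).trans ?_
          gcongr M * ?_
          have e := prod_div_rpow_eq hpq Y (fun _ : ι => 1) (by simp) (by simp)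
          simp only [ENNReal.one_rpow, Finset.prod_const_one, div_one] at e
          rw [hl, ← e, ← Finset.prod_mul_distrib]
          refine Finset.prod_le_prod' fun i _ => ?_
          rw [← ENNReal.mul_rpow_of_nonneg _ _ (hpq i)]
          exact ENNReal.rpow_le_rpow (hFn i (E i)) (hpq i)
      _ = _ := by
          rw [Finset.sum_const, nsmul_eq_mul, Finset.card_univ, Fintype.card_fun, hκ]
          push_cast
          rfl
  have hmain : κ * ∑ α ∈ s, μ (closedBall α ((1 - ‖α‖) / 20)) * X α ≤
      κ * (100000 * ((∏ i, (D i : ℝ≥0∞)) *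
        (M * ((∏ i, (C i : ℝ≥0∞) ^ (q i / p i)) * Y ^ l)))) := by
    calc κ * ∑ α ∈ s, μ (closedBall α ((1 - ‖α‖) / 20)) * X α
        = ∑ α ∈ s, ∫⁻ z in disc,
            (closedBall α ((1 - ‖α‖) / 20)).indicator (fun _ => κ * X α) z ∂μ := by
          rw [Finset.mul_sum]
          refine Finset.sum_congr rfl fun α hα => ?_
          rw [lintegral_indicator measurableSet_closedBall, setLIntegral_const,
            Measure.restrict_apply measurableSet_closedBall, inter_eq_left.2
              ((closedBall_div_mono (hsd hα) (by norm_num) (by norm_num)).trans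
                (closedBall_subset_disc (hsd hα)))]
          ring
      _ = ∫⁻ z in disc, ∑ α ∈ s,
            (closedBall α ((1 - ‖α‖) / 20)).indicator (fun _ => κ * X α) z ∂μ := by
          rw [lintegral_finsetSum _ fun α _ => measurable_const.indicator measurableSet_closedBall]
      _ ≤ ∫⁻ z in disc, 100000 * ((∏ i, (D i : ℝ≥0∞)) * H z) ∂μ :=
          setLIntegral_mono' measurableSet_disc hsum
      _ = 100000 * ((∏ i, (D i : ℝ≥0∞)) * ∫⁻ z in disc, H z ∂μ) := by
          rw [lintegral_const_mul' _ _ (by simp), lintegral_const_mul' _ _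
            (ENNReal.prod_ne_top fun i _ => ENNReal.coe_ne_top)]
      _ ≤ 100000 * ((∏ i, (D i : ℝ≥0∞)) *
          (κ * (M * ((∏ i, (C i : ℝ≥0∞) ^ (q i / p i)) * Y ^ l)))) := by gcongr
      _ = _ := by ring
  refine ((ENNReal.mul_le_mul_iff_right hκ0 hκt).1 hmain).trans (le_of_eq ?_)
  push_cast
  simp_rw [ENNReal.coe_rpow_of_nonneg _ (hpq _)]
  ring

/-- The local bound of an analytic function on a cell by its weighted integral over the enlarged
cell. -/
theorem PowerType.enorm_rpow_mul_cellWeight_le {v : ℝ → ℝ} {a b : ℝ} (h : PowerType v a b)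
    (ha : 0 ≤ a) (hb : 0 ≤ b) {p : ℝ} (hp : 0 < p) :
    ∃ C : ℝ≥0, ∀ f : ℂ → ℂ, DifferentiableOn ℂ f disc → ∀ α ∈ disc,
      ∀ z ∈ closedBall α ((1 - ‖α‖) / 20), ‖f z‖ₑ ^ p * cellWeight v α ≤
        C * ∫⁻ w in closedBall α ((1 - ‖α‖) / 10), ‖f w‖ₑ ^ p * ENNReal.ofReal (v ‖w‖) := by
  obtain ⟨C, hC⟩ := enorm_rpow_mul_sq_le hp
  refine ⟨400 * C * (2 : ℝ≥0) ^ (b + 1), fun f hf α hα z hz => ?_⟩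
  have hα1 : 0 < 1 - ‖α‖ := by linarith [mem_disc.1 hα]
  -- The radii `1/20` for the cell and `1/10` for the enlarged cell leave room for a disc of radius
  -- `(1 - |α|) / 20` about every point of the cell; the factor `400` below is `20 ^ 2`.
  have hsub : ball z ((1 - ‖α‖) / 20) ⊆ closedBall α ((1 - ‖α‖) / 10) := by
    intro w hw
    rw [mem_ball] at hw
    rw [mem_closedBall] at hz ⊢
    have := dist_triangle w z α
    linarith
  have hloc := hC f z ((1 - ‖α‖) / 20) (by positivity)
    (hf.mono (hsub.trans (closedBall_subset_disc hα)))
  have e1 : cellWeight v α =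
      400 * (ENNReal.ofReal (((1 - ‖α‖) / 20) ^ 2) * ENNReal.ofReal (v ‖α‖)) := by
    rw [cellWeight, show (400 : ℝ≥0∞) = ENNReal.ofReal 400 by simp,
      ← ENNReal.ofReal_mul (by positivity), ← ENNReal.ofReal_mul (by positivity)]
    congr 1
    ring
  calc ‖f z‖ₑ ^ p * cellWeight v α
      = 400 * ((‖f z‖ₑ ^ p * ENNReal.ofReal (((1 - ‖α‖) / 20) ^ 2)) * ENNReal.ofReal (v ‖α‖)) := by
        rw [e1]; ring
    _ ≤ 400 * ((C * ∫⁻ w in ball z ((1 - ‖α‖) / 20), ‖f w‖ₑ ^ p) * ENNReal.ofReal (v ‖α‖)) := by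
        gcongr
    _ ≤ 400 * ((C * ∫⁻ w in closedBall α ((1 - ‖α‖) / 10), ‖f w‖ₑ ^ p) *
          ENNReal.ofReal (v ‖α‖)) := by
        gcongr
    _ = 400 * (C * ∫⁻ w in closedBall α ((1 - ‖α‖) / 10), ‖f w‖ₑ ^ p * ENNReal.ofReal (v ‖α‖)) := by
        rw [lintegral_mul_const' _ _ ENNReal.ofReal_ne_top, mul_assoc]
    _ ≤ 400 * (C * ∫⁻ w in closedBall α ((1 - ‖α‖) / 10), (2 : ℝ≥0∞) ^ (b + 1) *
          (‖f w‖ₑ ^ p * ENNReal.ofReal (v ‖w‖))) := by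
        gcongr 400 * (C * ?_)
        refine setLIntegral_mono' measurableSet_closedBall fun w hw => ?_
        have h1 := ENNReal.ofReal_le_ofReal (h.le_of_mem_closedBall ha hb hα hw)
        rw [ENNReal.ofReal_mul (by positivity), ← ENNReal.ofReal_rpow_of_pos (by norm_num),
          ENNReal.ofReal_ofNat] at h1
        calc _ ≤ ‖f w‖ₑ ^ p * ((2 : ℝ≥0∞) ^ (b + 1) * ENNReal.ofReal (v ‖w‖)) := by gcongr
          _ = _ := by ring
    _ = _ := by
        rw [lintegral_const_mul' _ _ (ENNReal.rpow_ne_top_of_nonneg (by linarith) (by simp))]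
        push_cast
        rw [ENNReal.coe_rpow_of_nonneg _ (by linarith : 0 ≤ b + 1)]
        push_cast
        ring

theorem aemeasurable_enorm_rpow_mul {v : ℝ → ℝ} {a b : ℝ} (h : PowerType v a b) {f : ℂ → ℂ}
    (hf : DifferentiableOn ℂ f disc) (p : ℝ) :
    AEMeasurable (fun z => ‖f z‖ₑ ^ p * ENNReal.ofReal (v ‖z‖)) (volume.restrict disc) :=
  ((hf.continuousOn.aemeasurable measurableSet_disc).enorm.pow_const _).mul
    h.measurable_weight.aemeasurable

theorem IsLattice.sum_lintegral_closedBall_le (hu : IsLattice u) {s : Finset ℂ}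
    (hs : (s : Set ℂ) ⊆ u) {g : ℂ → ℝ≥0∞} (hg : AEMeasurable g (volume.restrict disc)) :
    ∑ α ∈ s, ∫⁻ w in closedBall α ((1 - ‖α‖) / 10), g w ≤ 100000 * ∫⁻ w in disc, g w := by
  have hsd := hs.trans hu.subset_disc
  calc ∑ α ∈ s, ∫⁻ w in closedBall α ((1 - ‖α‖) / 10), g w
      = ∑ α ∈ s, ∫⁻ w in disc, (closedBall α ((1 - ‖α‖) / 10)).indicator g w := by
        refine Finset.sum_congr rfl fun α hα => ?_
        rw [lintegral_indicator measurableSet_closedBall, Measure.restrict_restrict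
          measurableSet_closedBall, inter_eq_left.2 (closedBall_subset_disc (hsd hα))]
    _ = ∫⁻ w in disc, ∑ α ∈ s, (closedBall α ((1 - ‖α‖) / 10)).indicator g w := by
        rw [lintegral_finsetSum' _ fun α _ => hg.indicator measurableSet_closedBall]
    _ ≤ ∫⁻ w in disc, 100000 * g w := by
        refine setLIntegral_mono' measurableSet_disc fun w hw => ?_
        calc _ = (∑ α ∈ s, (closedBall α ((1 - ‖α‖) / 10)).indicator (1 : ℂ → ℝ≥0∞) w) * g w := by
              rw [Finset.sum_mul]
              refine Finset.sum_congr rfl fun α _ => ?_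
              by_cases hmem : w ∈ closedBall α ((1 - ‖α‖) / 10) <;> simp [hmem]
          _ ≤ _ := by
              gcongr
              exact hu.sum_indicator_le hs hw
    _ = _ := lintegral_const_mul' _ _ (by simp)

/-- The discrete Carleson inequality implies the multilinear one. -/
theorem SeqBound.multiBound [Nonempty ι] (hv : ∀ i, PowerType (v i) (a i) (b i))
    (ha : ∀ i, 0 < a i) (hb : ∀ i, 0 ≤ b i) (hp : ∀ i, 0 < p i) (hq : ∀ i, 0 < q i)
    (hu : IsLattice u) :
    ∃ C : ℝ≥0, ∀ (μ : Measure ℂ) (N : ℝ≥0∞),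
      SeqBound u (∑ i, q i / p i) (fun α => ∏ i, cellWeight (v i) α ^ (q i / p i)) μ N →
        MultiBound p q v μ (C * N) := by
  have hpq : ∀ i, 0 < q i / p i := fun i => div_pos (hq i) (hp i)
  choose C hC using fun i => (hv i).enorm_rpow_mul_cellWeight_le (ha i).le (hb i) (hp i)
  refine ⟨∏ i, (C i * 100000) ^ (q i / p i), fun μ N hN f hf hfin => ?_⟩
  set l := ∑ i, q i / p i with hl
  have hl0 : 0 < l := Finset.sum_pos (fun i _ => hpq i) Finset.univ_nonempty
  set θ : ι → ℝ := fun i => (q i / p i) / l with hθ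
  have hθ0 : ∀ i, 0 ≤ θ i := fun i => (div_pos (hpq i) hl0).le
  have hθ1 : ∑ i, θ i = 1 := by
    rw [hθ, ← Finset.sum_div, ← hl, div_self hl0.ne']
  have hθl : ∀ i, θ i * l = q i / p i := fun i => div_mul_cancel₀ _ hl0.ne'
  set B : ι → ℝ≥0∞ := fun i => weightedIntegral (p i) (v i) (f i) with hB
  set X : ι → ℂ → ℝ≥0∞ := fun i α => ∫⁻ w in closedBall α ((1 - ‖α‖) / 10),
    ‖f i w‖ₑ ^ p i * ENNReal.ofReal (v i ‖w‖) with hX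
  have hsumX : ∀ i, ∀ s : Finset ℂ, (s : Set ℂ) ⊆ u → ∑ α ∈ s, X i α ≤ 100000 * B i :=
    fun i s hs => hu.sum_lintegral_closedBall_le hs (aemeasurable_enorm_rpow_mul (hv i) (hf i) _)
  have hXt : ∀ i, ∀ α ∈ disc, X i α ≠ ∞ := fun i α hα =>
    ((lintegral_mono_set (closedBall_subset_disc hα)).trans_lt (hfin i)).ne
  -- This choice meets two demands: `y ^ l` is the product of the `X i ^ (q i / p i)` that bounds
  -- the integrand on a cell, and the exponents `θ i` sum to `1`, so Hölder bounds `∑ y` by the sums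
  -- of the `X i`.
  set y : ℂ → ℝ≥0 := fun α => (∏ i, X i α ^ θ i).toNNReal with hy
  have hyc : ∀ α ∈ disc, (y α : ℝ≥0∞) = ∏ i, X i α ^ θ i := fun α hα =>
    ENNReal.coe_toNNReal (ENNReal.prod_ne_top fun i _ =>
      ENNReal.rpow_ne_top_of_nonneg (hθ0 i) (hXt i α hα))
  have hyl : ∀ α ∈ disc, (y α : ℝ≥0∞) ^ l = ∏ i, X i α ^ (q i / p i) := by
    intro α hα
    rw [hyc α hα, ← ENNReal.prod_rpow_of_nonneg hl0.le]
    exact Finset.prod_congr rfl fun i _ => by rw [← ENNReal.rpow_mul, hθl]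
  set W : ℂ → ℝ≥0∞ := fun α => ∏ i, cellWeight (v i) α ^ (q i / p i) with hW
  set K : ℝ≥0∞ := ∏ i, (C i : ℝ≥0∞) ^ (q i / p i) with hK
  have hpt : ∀ α ∈ disc, ∀ z ∈ closedBall α ((1 - ‖α‖) / 20),
      ∏ i, ‖f i z‖ₑ ^ q i ≤ K * ((y α : ℝ≥0∞) ^ l / W α) := by
    intro α hα z hz
    have h0 : ∀ i, cellWeight (v i) α ≠ 0 := fun i => (hv i).cellWeight_ne_zero hα
    have ht : ∀ i, cellWeight (v i) α ≠ ∞ := fun i => cellWeight_ne_top _ _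
    have hW0 : W α ≠ 0 := Finset.prod_ne_zero_iff.2 fun i _ => by simp [h0 i, ht i]
    have hWt : W α ≠ ∞ := ENNReal.prod_ne_top fun i _ =>
      ENNReal.rpow_ne_top_of_nonneg (hpq i).le (ht i)
    rw [hyl α hα, ← mul_div_assoc, ENNReal.le_div_iff_mul_le (Or.inl hW0) (Or.inl hWt), hK, hW,
      ← Finset.prod_mul_distrib, ← Finset.prod_mul_distrib]
    refine Finset.prod_le_prod' fun i _ => ?_
    have := ENNReal.rpow_le_rpow (hC i (f i) (hf i) α hα z hz) (hpq i).le
    rwa [ENNReal.mul_rpow_of_nonneg _ _ (hpq i).le, ENNReal.mul_rpow_of_nonneg _ _ (hpq i).le,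
      ← ENNReal.rpow_mul, mul_div_cancel₀ _ (hp i).ne'] at this
  have : Countable u := hu.countable.to_subtype
  have hcover : disc ⊆ ⋃ α : u, closedBall (α : ℂ) ((1 - ‖(α : ℂ)‖) / 20) := by
    intro z hz
    obtain ⟨α, hα, hzα⟩ := hu.cover z hz
    exact mem_iUnion.2 ⟨⟨α, hα⟩, hzα⟩
  have hfinite : ∀ s : Finset ℂ, (s : Set ℂ) ⊆ u →
      ∑ α ∈ s, μ (closedBall α ((1 - ‖α‖) / 20)) * ((y α : ℝ≥0∞) ^ l / W α) ≤
        N * ∏ i, (100000 * B i) ^ (q i / p i) := by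
    intro s hs
    refine (hN s hs y).trans ?_
    gcongr
    have h1 : ∑ α ∈ s, (y α : ℝ≥0∞) ≤ ∏ i, (100000 * B i) ^ θ i := by
      calc ∑ α ∈ s, (y α : ℝ≥0∞) = ∑ α ∈ s, ∏ i, X i α ^ θ i :=
            Finset.sum_congr rfl fun α hα => hyc α (hu.subset_disc (hs hα))
        _ ≤ ∏ i, (∑ α ∈ s, X i α) ^ θ i := sum_prod_rpow_le s X hθ1 hθ0
        _ ≤ _ := Finset.prod_le_prod' fun i _ => ENNReal.rpow_le_rpow (hsumX i s hs) (hθ0 i)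
    refine (ENNReal.rpow_le_rpow h1 hl0.le).trans (le_of_eq ?_)
    rw [← ENNReal.prod_rpow_of_nonneg hl0.le]
    exact Finset.prod_congr rfl fun i _ => by rw [← ENNReal.rpow_mul, hθl]
  calc ∫⁻ z in disc, ∏ i, ‖f i z‖ₑ ^ q i ∂μ
      ≤ ∑' α : u, ∫⁻ z in closedBall (α : ℂ) ((1 - ‖(α : ℂ)‖) / 20), ∏ i, ‖f i z‖ₑ ^ q i ∂μ :=
        (lintegral_mono_set hcover).trans (lintegral_iUnion_le _ _)
    _ ≤ ∑' α : u, K * (μ (closedBall (α : ℂ) ((1 - ‖(α : ℂ)‖) / 20)) *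
          ((y α : ℝ≥0∞) ^ l / W α)) := by
        refine ENNReal.tsum_le_tsum fun α => ?_
        refine (setLIntegral_mono' measurableSet_closedBall
          (hpt α (hu.subset_disc α.2))).trans (le_of_eq ?_)
        rw [setLIntegral_const]
        ring
    _ = K * ∑' α : u, μ (closedBall (α : ℂ) ((1 - ‖(α : ℂ)‖) / 20)) *
          ((y α : ℝ≥0∞) ^ l / W α) := ENNReal.tsum_mul_left
    _ ≤ K * (N * ∏ i, (100000 * B i) ^ (q i / p i)) := by
        gcongr
        -- The discrete inequality concerns finite subsets of the lattice, and its bound here is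
        -- uniform in them.
        rw [ENNReal.tsum_eq_iSup_sum]
        refine iSup_le fun t => ?_
        have := hfinite (t.map (Function.Embedding.subtype _)) (by
          intro α hα
          simp only [Finset.coe_map, mem_image] at hα
          obtain ⟨β, _, rfl⟩ := hα
          exact β.2)
        rwa [Finset.sum_map] at this
    _ = _ := by
        push_cast
        simp_rw [ENNReal.mul_rpow_of_nonneg _ _ (hpq _).le, ENNReal.coe_rpow_of_nonneg _ (hpq _).le]
        push_cast
        simp_rw [ENNReal.mul_rpow_of_nonneg _ _ (hpq _).le, Finset.prod_mul_distrib]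
        ring

end

/-! ### Regular weights are equivalent to weights of power type -/

/-- Two weights are equivalent if each is bounded by a multiple of the other on `[0,1)`. -/
def WeightEquiv (ω v : ℝ → ℝ) : Prop :=
  ∃ K : ℝ, 0 < K ∧ ∀ r ∈ Ico (0 : ℝ) 1, ω r ≤ K * v r ∧ v r ≤ K * ω r

/-- Exponential decay from its infinitesimal form. -/
theorem mul_exp_le_of_step {ψ : ℝ → ℝ} {A : ℝ} (hA : 0 ≤ A)
    (h : ∀ x δ, 0 ≤ x → 0 ≤ δ → ψ (x + δ) * (1 + A * δ) ≤ ψ x) {x L : ℝ} (hx : 0 ≤ x)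
    (hL : 0 ≤ L) : ψ (x + L) * Real.exp (A * L) ≤ ψ x := by
  have hk : ∀ (δ : ℝ), 0 ≤ δ → ∀ k : ℕ, ψ (x + k * δ) * (1 + A * δ) ^ k ≤ ψ x := by
    intro δ hδ k
    induction k with
    | zero => simp
    | succ k ih =>
      have h1 := h (x + k * δ) δ (by positivity) hδ
      have h2 : x + ((k + 1 : ℕ) : ℝ) * δ = x + k * δ + δ := by push_cast; ring
      rw [h2, pow_succ']
      calc ψ (x + k * δ + δ) * ((1 + A * δ) * (1 + A * δ) ^ k)
          = ψ (x + k * δ + δ) * (1 + A * δ) * (1 + A * δ) ^ k := by ring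
        _ ≤ ψ (x + k * δ) * (1 + A * δ) ^ k := by gcongr
        _ ≤ ψ x := ih
  -- The interval is cut into `n` equal steps and `(1 + A L / n) ^ n` tends to the exponential, so
  -- `ψ` need not be differentiable.
  have hlim : Tendsto (fun n : ℕ => ψ (x + L) * (1 + A * L / n) ^ n) atTop
      (𝓝 (ψ (x + L) * Real.exp (A * L))) :=
    (Real.tendsto_one_add_div_pow_exp (A * L)).const_mul _
  refine le_of_tendsto hlim ?_
  filter_upwards [eventually_gt_atTop 0] with n hn
  have hn' : (0 : ℝ) < n := by exact_mod_cast hn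
  have := hk (L / n) (by positivity) n
  rwa [mul_div_cancel₀ _ hn'.ne', ← mul_div_assoc] at this

/-- Exponential lower bounds from their infinitesimal form. -/
theorem mul_exp_neg_le_of_step {ψ : ℝ → ℝ} {B : ℝ}
    (h : ∀ x δ, 0 ≤ x → 0 ≤ δ → ψ x * (1 - B * δ) ≤ ψ (x + δ)) {x L : ℝ} (hx : 0 ≤ x)
    (hL : 0 ≤ L) : ψ x * Real.exp (-(B * L)) ≤ ψ (x + L) := by
  have hk : ∀ (δ : ℝ), 0 ≤ δ → B * δ ≤ 1 → ∀ k : ℕ, ψ x * (1 - B * δ) ^ k ≤ ψ (x + k * δ) := by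
    intro δ hδ hBδ k
    induction k with
    | zero => simp
    | succ k ih =>
      have h1 := h (x + k * δ) δ (by positivity) hδ
      have h2 : x + ((k + 1 : ℕ) : ℝ) * δ = x + k * δ + δ := by push_cast; ring
      rw [h2, pow_succ, ← mul_assoc]
      exact (mul_le_mul_of_nonneg_right ih (by linarith)).trans h1
  have hlim : Tendsto (fun n : ℕ => ψ x * (1 + -(B * L) / n) ^ n) atTop
      (𝓝 (ψ x * Real.exp (-(B * L)))) :=
    (Real.tendsto_one_add_div_pow_exp (-(B * L))).const_mul _
  refine le_of_tendsto hlim ?_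
  -- Here `n ≥ B L` is needed so that the factor `1 - B δ` is nonnegative in the induction.
  filter_upwards [eventually_gt_atTop 0, eventually_ge_atTop ⌈B * L⌉₊] with n hn hnB
  have hn' : (0 : ℝ) < n := by exact_mod_cast hn
  have hB : B * L ≤ n := (Nat.le_ceil _).trans (by exact_mod_cast hnB)
  have := hk (L / n) (by positivity) (by rw [← mul_div_assoc]; exact (div_le_one hn').2 hB) n
  rwa [mul_div_cancel₀ _ hn'.ne', ← mul_div_assoc, sub_eq_add_neg, ← neg_div] at this

theorem integral_inv_one_sub {r s : ℝ} (hrs : r ≤ s) (hs : s < 1) :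
    ∫ t in r..s, (1 - t)⁻¹ = Real.log ((1 - r) / (1 - s)) := by
  rw [intervalIntegral.integral_comp_sub_left (fun t : ℝ => t⁻¹),
    integral_inv_of_pos (by linarith) (by linarith)]

theorem IsRadialWeight.intervalIntegrable {ω : ℝ → ℝ} (h : IsRadialWeight ω) {r s : ℝ}
    (hr : r ∈ Icc (0 : ℝ) 1) (hs : s ∈ Icc (0 : ℝ) 1) : IntervalIntegrable ω volume r s := by
  have h1 : IntegrableOn ω (Icc 0 1) := (integrableOn_Icc_iff_integrableOn_Ico (by simp)).2 h.integrable
  exact (h1.mono_set (uIcc_subset_Icc hr hs)).intervalIntegrable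

theorem IsRadialWeight.tail_sub_tail {ω : ℝ → ℝ} (h : IsRadialWeight ω) {r s : ℝ}
    (hr : r ∈ Icc (0 : ℝ) 1) (hs : s ∈ Icc (0 : ℝ) 1) : tail ω r - tail ω s = ∫ t in r..s, ω t := by
  have h1 : (1 : ℝ) ∈ Icc (0 : ℝ) 1 := by simp
  rw [tail, tail, sub_eq_iff_eq_add, intervalIntegral.integral_add_adjacent_intervals
    (h.intervalIntegrable hr hs) (h.intervalIntegrable hs h1)]

theorem IsRadialWeight.tail_anti {ω : ℝ → ℝ} (h : IsRadialWeight ω) {r s : ℝ}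
    (hr : 0 ≤ r) (hrs : r ≤ s) (hs : s < 1) : tail ω s ≤ tail ω r := by
  have h1 := h.tail_sub_tail ⟨hr, by linarith⟩ ⟨hr.trans hrs, hs.le⟩
  have h2 : 0 ≤ ∫ t in r..s, ω t := intervalIntegral.integral_nonneg hrs fun t ht =>
    (h.pos t ⟨hr.trans ht.1, ht.2.trans_lt hs⟩).le
  linarith

/-- The continuous regularization `tail ω r / (1 - r)` of a weight. -/
def regularization (ω : ℝ → ℝ) : ℝ → ℝ := (Ico (0 : ℝ) 1).indicator fun r => tail ω r / (1 - r)

theorem IsRadialWeight.measurable_regularization {ω : ℝ → ℝ} (h : IsRadialWeight ω) :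
    Measurable (regularization ω) := by
  classical
  have h1 : IntegrableOn ω (uIcc 0 1) := by
    rw [uIcc_of_le zero_le_one]
    exact (integrableOn_Icc_iff_integrableOn_Ico (by simp)).2 h.integrable
  have h2 : ContinuousOn (tail ω) (Ico 0 1) := by
    have := intervalIntegral.continuousOn_primitive_interval_left h1
    rw [uIcc_of_le zero_le_one] at this
    exact this.mono Ico_subset_Icc_self
  rw [regularization, ← Set.piecewise_eq_indicator]
  refine ContinuousOn.measurable_piecewise (h2.div (by fun_prop) fun r hr => ?_)
    continuousOn_const measurableSet_Ico
  linarith [hr.2]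

/-- A regular weight is equivalent to a weight of power type. -/
theorem IsRegularWeight.exists_powerType {ω : ℝ → ℝ} (h : IsRegularWeight ω) :
    ∃ (v : ℝ → ℝ) (a b : ℝ), PowerType v a b ∧ 0 < a ∧ 0 ≤ b ∧ WeightEquiv ω v := by
  obtain ⟨c, C, hc, hcC⟩ := h.comparable
  have hC : 0 < C := by
    have := hcC 0 (by simp)
    linarith [this.1.trans this.2]
  have hden : ∀ r ∈ Ico (0 : ℝ) 1, 0 < (1 - r) * ω r := fun r hr =>
    mul_pos (by linarith [hr.2]) (h.pos r hr)
  have hlow : ∀ r ∈ Ico (0 : ℝ) 1, c * ((1 - r) * ω r) ≤ tail ω r := fun r hr =>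
    (le_div_iff₀ (hden r hr)).1 (hcC r hr).1
  have hupp : ∀ r ∈ Ico (0 : ℝ) 1, tail ω r ≤ C * ((1 - r) * ω r) := fun r hr =>
    (div_le_iff₀ (hden r hr)).1 (hcC r hr).2
  have hpos : ∀ r ∈ Ico (0 : ℝ) 1, 0 < tail ω r := fun r hr =>
    (mul_pos hc (hden r hr)).trans_le (hlow r hr)
  have hinv : ∀ {r s : ℝ}, 0 ≤ r → r ≤ s → s < 1 → ∀ k : ℝ,
      IntervalIntegrable (fun t => k * (1 - t)⁻¹) volume r s := by
    intro r s hr hrs hs k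
    refine ContinuousOn.intervalIntegrable (continuousOn_const.mul
      (ContinuousOn.inv₀ (by fun_prop) fun t ht => ?_))
    rw [uIcc_of_le hrs] at ht
    linarith [ht.2]
  -- On `[r, s]` regularity and monotonicity of the tail give `ω t ≥ C⁻¹ tail ω s / (1 - t)`;
  -- integration produces the logarithm. The companion estimate uses `c` and `tail ω r` in the same
  -- way.
  have hstep1 : ∀ r s, 0 ≤ r → r ≤ s → s < 1 →
      tail ω s * (1 + C⁻¹ * Real.log ((1 - r) / (1 - s))) ≤ tail ω r := by
    intro r s hr hrs hs
    have h1 := h.tail_sub_tail (r := r) (s := s) ⟨hr, by linarith⟩ ⟨hr.trans hrs, hs.le⟩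
    have h2 : ∫ t in r..s, (C⁻¹ * tail ω s) * (1 - t)⁻¹ ≤ ∫ t in r..s, ω t := by
      refine intervalIntegral.integral_mono_on hrs (hinv hr hrs hs _)
        (h.intervalIntegrable ⟨hr, by linarith⟩ ⟨hr.trans hrs, hs.le⟩) fun t ht => ?_
      have ht' : t ∈ Ico (0 : ℝ) 1 := ⟨hr.trans ht.1, ht.2.trans_lt hs⟩
      have h3 := (h.tail_anti ht'.1 ht.2 hs).trans (hupp t ht')
      have h4 : 0 < 1 - t := by linarith [ht'.2]
      rw [← div_eq_mul_inv, div_le_iff₀ h4, inv_mul_le_iff₀ hC]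
      linarith
    rw [intervalIntegral.integral_const_mul, integral_inv_one_sub hrs hs] at h2
    linarith
  have hstep2 : ∀ r s, 0 ≤ r → r ≤ s → s < 1 →
      tail ω r * (1 - c⁻¹ * Real.log ((1 - r) / (1 - s))) ≤ tail ω s := by
    intro r s hr hrs hs
    have h1 := h.tail_sub_tail (r := r) (s := s) ⟨hr, by linarith⟩ ⟨hr.trans hrs, hs.le⟩
    have h2 : ∫ t in r..s, ω t ≤ ∫ t in r..s, (c⁻¹ * tail ω r) * (1 - t)⁻¹ := by
      refine intervalIntegral.integral_mono_on hrs
        (h.intervalIntegrable ⟨hr, by linarith⟩ ⟨hr.trans hrs, hs.le⟩) (hinv hr hrs hs _)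
        fun t ht => ?_
      have ht' : t ∈ Ico (0 : ℝ) 1 := ⟨hr.trans ht.1, ht.2.trans_lt hs⟩
      have h3 := (hlow t ht').trans (h.tail_anti hr ht.1 ht'.2)
      have h4 : 0 < 1 - t := by linarith [ht'.2]
      rw [← div_eq_mul_inv, le_div_iff₀ h4, le_inv_mul_iff₀ hc]
      linarith
    rw [intervalIntegral.integral_const_mul, integral_inv_one_sub hrs hs] at h2
    linarith
  -- With `r = 1 - exp (-x)` the logarithm becomes the increment of `x`, and powers of `(1 - s) / (1
  -- - r)` become exponentials.
  set ψ : ℝ → ℝ := fun x => tail ω (1 - Real.exp (-x)) with hψ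
  have hlog : ∀ x δ : ℝ, Real.log ((1 - (1 - Real.exp (-x))) / (1 - (1 - Real.exp (-(x + δ))))) =
      δ := by
    intro x δ
    rw [sub_sub_cancel, sub_sub_cancel, ← Real.exp_sub, Real.log_exp]
    ring
  have hdom : ∀ x δ : ℝ, 0 ≤ x → 0 ≤ δ → 0 ≤ 1 - Real.exp (-x) ∧
      1 - Real.exp (-x) ≤ 1 - Real.exp (-(x + δ)) ∧ 1 - Real.exp (-(x + δ)) < 1 := by
    intro x δ hx hδ
    refine ⟨?_, ?_, ?_⟩
    · linarith [Real.exp_le_one_iff.2 (by linarith : -x ≤ 0)]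
    · linarith [Real.exp_le_exp.2 (by linarith : -(x + δ) ≤ -x)]
    · linarith [Real.exp_pos (-(x + δ))]
  have hψ1 : ∀ x δ, 0 ≤ x → 0 ≤ δ → ψ (x + δ) * (1 + C⁻¹ * δ) ≤ ψ x := by
    intro x δ hx hδ
    obtain ⟨d1, d2, d3⟩ := hdom x δ hx hδ
    have := hstep1 _ _ d1 d2 d3
    rwa [hlog] at this
  have hψ2 : ∀ x δ, 0 ≤ x → 0 ≤ δ → ψ x * (1 - c⁻¹ * δ) ≤ ψ (x + δ) := by
    intro x δ hx hδ
    obtain ⟨d1, d2, d3⟩ := hdom x δ hx hδ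
    have := hstep2 _ _ d1 d2 d3
    rwa [hlog] at this
  have hsub : ∀ r s, 0 ≤ r → r ≤ s → s < 1 → ∃ x L, 0 ≤ x ∧ 0 ≤ L ∧ ψ x = tail ω r ∧
      ψ (x + L) = tail ω s ∧ ∀ e : ℝ, ((1 - s) / (1 - r)) ^ e = Real.exp (-(e * L)) := by
    intro r s hr hrs hs
    have hr1 : 0 < 1 - r := by linarith
    have hs1 : 0 < 1 - s := by linarith
    refine ⟨-Real.log (1 - r), Real.log (1 - r) - Real.log (1 - s), ?_, ?_, ?_, ?_, ?_⟩
    · linarith [Real.log_nonpos hr1.le (by linarith)]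
    · linarith [Real.log_le_log hs1 (by linarith : 1 - s ≤ 1 - r)]
    · simp only [hψ, neg_neg, Real.exp_log hr1, sub_sub_cancel]
    · simp only [hψ]
      rw [show -(-Real.log (1 - r) + (Real.log (1 - r) - Real.log (1 - s))) = Real.log (1 - s) by
        ring, Real.exp_log hs1, sub_sub_cancel]
    · intro e
      rw [Real.rpow_def_of_pos (by positivity), Real.log_div hs1.ne' hr1.ne']
      congr 1
      ring
  have hreg : ∀ r ∈ Ico (0 : ℝ) 1, regularization ω r * (1 - r) = tail ω r := by
    intro r hr
    rw [regularization, indicator_of_mem hr, div_mul_cancel₀]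
    linarith [hr.2]
  -- Since `(1 - r)` times the regularization is the tail, its decay rates are the power-type
  -- exponents: `1 / C` from the upper regularity constant and `1 / c` from the lower one.
  refine ⟨regularization ω, C⁻¹, c⁻¹, ⟨h.measurable_regularization, ?_, ?_, ?_⟩, by positivity,
    by positivity, c⁻¹ + C, by positivity, ?_⟩
  · intro r hr
    rw [regularization, indicator_of_mem hr]
    exact div_pos (hpos r hr) (by linarith [hr.2])
  · intro r s hr hrs hs
    rw [hreg s ⟨hr.trans hrs, hs⟩, hreg r ⟨hr, hrs.trans_lt hs⟩]
    obtain ⟨x, L, hx, hL, e1, e2, e3⟩ := hsub r s hr hrs hs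
    rw [← e1, ← e2, e3, Real.exp_neg, ← div_eq_mul_inv, le_div_iff₀ (Real.exp_pos _)]
    exact mul_exp_le_of_step (by positivity) hψ1 hx hL
  · intro r s hr hrs hs
    rw [hreg s ⟨hr.trans hrs, hs⟩, hreg r ⟨hr, hrs.trans_lt hs⟩]
    obtain ⟨x, L, hx, hL, e1, e2, e3⟩ := hsub r s hr hrs hs
    rw [← e1, ← e2, e3]
    exact mul_exp_neg_le_of_step hψ2 hx hL
  · intro r hr
    have h1r : 0 < 1 - r := by linarith [hr.2]
    have hv : 0 < tail ω r / (1 - r) := div_pos (hpos r hr) h1r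
    have hω := h.pos r hr
    rw [regularization, indicator_of_mem hr]
    constructor
    · have : ω r ≤ c⁻¹ * (tail ω r / (1 - r)) := by
        rw [le_inv_mul_iff₀ hc, le_div_iff₀ h1r]
        linarith [hlow r hr]
      nlinarith [mul_pos hC hv]
    · have : tail ω r / (1 - r) ≤ C * ω r := by
        rw [div_le_iff₀ h1r]
        linarith [hupp r hr]
      nlinarith [mul_pos (inv_pos.2 hc) hω]

/-- Geometric means of weights of power type are of power type. -/
theorem PowerType.prod_rpow {ι : Type*} [Fintype ι] {v : ι → ℝ → ℝ} {a b θ : ι → ℝ}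
    (hv : ∀ i, PowerType (v i) (a i) (b i)) (hθ : ∑ i, θ i = 1) (hθ0 : ∀ i, 0 ≤ θ i) :
    PowerType (fun r => ∏ i, v i r ^ θ i) (∑ i, θ i * a i) (∑ i, θ i * b i) := by
  -- As the `θ i` sum to `1`, the factor `1 - r` distributes over the product, and the defining
  -- inequalities can be multiplied factor by factor.
  have hfac : ∀ r ∈ Ico (0 : ℝ) 1, (∏ i, v i r ^ θ i) * (1 - r) = ∏ i, (v i r * (1 - r)) ^ θ i := by
    intro r hr
    have h1 : 0 < 1 - r := by linarith [hr.2]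
    have h2 : (1 - r) = ∏ i, (1 - r) ^ θ i := by
      rw [← Real.rpow_sum_of_pos h1, hθ, Real.rpow_one]
    conv_lhs => rw [h2]
    rw [← Finset.prod_mul_distrib]
    exact Finset.prod_congr rfl fun i _ =>
      (Real.mul_rpow ((hv i).pos r hr).le h1.le).symm
  have hpow : ∀ (x : ℝ) (e : ι → ℝ), 0 < x → x ^ (∑ i, θ i * e i) = ∏ i, (x ^ e i) ^ θ i := by
    intro x e hx
    rw [Real.rpow_sum_of_pos hx]
    exact Finset.prod_congr rfl fun i _ => by rw [← Real.rpow_mul hx.le, mul_comm]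
  have hmul : ∀ r s (e : ι → ℝ), 0 ≤ r → r ≤ s → s < 1 →
      (∏ i, v i r ^ θ i) * (1 - r) * ((1 - s) / (1 - r)) ^ (∑ i, θ i * e i) =
        ∏ i, (v i r * (1 - r) * ((1 - s) / (1 - r)) ^ e i) ^ θ i := by
    intro r s e hr hrs hs
    have h1 : 0 < 1 - r := by linarith
    have h2 : 0 < 1 - s := by linarith
    rw [hfac r ⟨hr, hrs.trans_lt hs⟩, hpow _ e (by positivity), ← Finset.prod_mul_distrib]
    refine Finset.prod_congr rfl fun i _ => ?_
    have := (hv i).pos r ⟨hr, hrs.trans_lt hs⟩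
    exact (Real.mul_rpow (by positivity) (by positivity)).symm
  refine ⟨Finset.measurable_fun_prod _ fun i _ => (hv i).measurable.pow_const _, fun r hr =>
    Finset.prod_pos fun i _ => Real.rpow_pos_of_pos ((hv i).pos r hr) _, ?_, ?_⟩
  · intro r s hr hrs hs
    rw [hmul r s a hr hrs hs, hfac s ⟨hr.trans hrs, hs⟩]
    refine Finset.prod_le_prod (fun i _ => ?_) fun i _ => ?_
    · have := (hv i).pos s ⟨hr.trans hrs, hs⟩
      have h2 : 0 < 1 - s := by linarith
      positivity
    · have := (hv i).pos s ⟨hr.trans hrs, hs⟩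
      have h2 : 0 < 1 - s := by linarith
      exact Real.rpow_le_rpow (by positivity) ((hv i).upper r s hr hrs hs) (hθ0 i)
  · intro r s hr hrs hs
    rw [hmul r s b hr hrs hs, hfac s ⟨hr.trans hrs, hs⟩]
    have h1 : 0 < 1 - r := by linarith
    have h2 : 0 < 1 - s := by linarith
    refine Finset.prod_le_prod (fun i _ => ?_) fun i _ => ?_
    · have := (hv i).pos r ⟨hr, hrs.trans_lt hs⟩
      positivity
    · have := (hv i).pos r ⟨hr, hrs.trans_lt hs⟩
      exact Real.rpow_le_rpow (by positivity) ((hv i).lower r s hr hrs hs) (hθ0 i)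

theorem WeightEquiv.prod_rpow {ι : Type*} [Fintype ι] {ω v : ι → ℝ → ℝ} {θ : ι → ℝ}
    (h : ∀ i, WeightEquiv (ω i) (v i)) (hω : ∀ i, ∀ r ∈ Ico (0 : ℝ) 1, 0 < ω i r)
    (hv : ∀ i, ∀ r ∈ Ico (0 : ℝ) 1, 0 < v i r) (hθ0 : ∀ i, 0 ≤ θ i) :
    WeightEquiv (fun r => ∏ i, ω i r ^ θ i) (fun r => ∏ i, v i r ^ θ i) := by
  choose K hK hKb using h
  refine ⟨∏ i, K i ^ θ i, Finset.prod_pos fun i _ => Real.rpow_pos_of_pos (hK i) _,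
    fun r hr => ⟨?_, ?_⟩⟩ <;> rw [← Finset.prod_mul_distrib]
  · refine Finset.prod_le_prod (fun i _ => (Real.rpow_pos_of_pos (hω i r hr) _).le) fun i _ => ?_
    rw [← Real.mul_rpow (hK i).le (hv i r hr).le]
    exact Real.rpow_le_rpow (hω i r hr).le (hKb i r hr).1 (hθ0 i)
  · refine Finset.prod_le_prod (fun i _ => (Real.rpow_pos_of_pos (hv i r hr) _).le) fun i _ => ?_
    rw [← Real.mul_rpow (hK i).le (hω i r hr).le]
    exact Real.rpow_le_rpow (hv i r hr).le (hKb i r hr).2 (hθ0 i)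

/-! ### From Bergman norms to weighted integrals -/

section

theorem areaMeasure_restrict_disc : areaMeasure.restrict disc = areaMeasure := by
  rw [areaMeasure, Measure.restrict_smul, Measure.restrict_restrict measurableSet_disc, inter_self]

theorem ae_areaMeasure_of_forall {P : ℂ → Prop} (h : ∀ z ∈ disc, P z) : ∀ᵐ z ∂areaMeasure, P z := by
  rw [← areaMeasure_restrict_disc]
  exact (ae_restrict_iff' measurableSet_disc).2 (Filter.Eventually.of_forall h)

theorem lintegral_areaMeasure (g : ℂ → ℝ≥0∞) :
    ∫⁻ z, g z ∂areaMeasure = ENNReal.ofReal Real.pi⁻¹ * ∫⁻ z in disc, g z := by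
  rw [areaMeasure, lintegral_smul_measure, smul_eq_mul]

theorem lpNorm_eq {p : ℝ} (hp : 0 < p) (μ : Measure ℂ) (f : ℂ → ℂ) :
    lpNorm p μ f = (∫⁻ z in disc, ‖f z‖ₑ ^ p ∂μ) ^ p⁻¹ := by
  rw [lpNorm, eLpNorm_eq_lintegral_rpow_enorm_toReal (by simpa using hp) ENNReal.ofReal_ne_top,
    ENNReal.toReal_ofReal hp.le, one_div]

theorem lpNorm_rpow {p : ℝ} (hp : 0 < p) (μ : Measure ℂ) (f : ℂ → ℂ) (q : ℝ) :
    lpNorm p μ f ^ q = (∫⁻ z in disc, ‖f z‖ₑ ^ p ∂μ) ^ (q / p) := by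
  rw [lpNorm_eq hp, ← ENNReal.rpow_mul, inv_mul_eq_div]

/-- The integral against `v dA` in terms of the plain area integral. -/
theorem PowerType.lintegral_withDensity {v : ℝ → ℝ} {a b : ℝ} (h : PowerType v a b) {f : ℂ → ℂ}
    (hf : DifferentiableOn ℂ f disc) (p : ℝ) {k : ℝ} (hk : 0 ≤ k) :
    ∫⁻ z in disc, ‖f z‖ₑ ^ p ∂areaMeasure.withDensity (fun z => ENNReal.ofReal (k * v ‖z‖)) =
      ENNReal.ofReal (Real.pi⁻¹ * k) * weightedIntegral p v f := by
  have hm : AEMeasurable (fun z => ‖f z‖ₑ ^ p) areaMeasure := by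
    rw [← areaMeasure_restrict_disc]
    exact (hf.continuousOn.aemeasurable measurableSet_disc).enorm.pow_const _
  have hd : Measurable fun z : ℂ => ENNReal.ofReal (k * v ‖z‖) :=
    ((h.measurable.comp measurable_norm).const_mul k).ennreal_ofReal
  rw [restrict_withDensity measurableSet_disc, areaMeasure_restrict_disc,
    lintegral_withDensity_eq_lintegral_mul₀ hd.aemeasurable hm, lintegral_areaMeasure,
    ENNReal.ofReal_mul (by positivity), mul_assoc, weightedIntegral,
    ← lintegral_const_mul' (ENNReal.ofReal k) _ ENNReal.ofReal_ne_top]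
  congr 1
  refine lintegral_congr fun z => ?_
  rw [Pi.mul_apply, ENNReal.ofReal_mul hk]
  ring

/-- Equivalent weights give comparable integrals. -/
theorem WeightEquiv.exists_integral_bound {ω v : ℝ → ℝ} {a b : ℝ} (hv : PowerType v a b)
    (h : WeightEquiv ω v) (p : ℝ) :
    ∃ D : ℝ≥0, ∀ f : ℂ → ℂ, DifferentiableOn ℂ f disc →
      ∫⁻ z in disc, ‖f z‖ₑ ^ p ∂weightMeasure ω ≤ D * weightedIntegral p v f ∧
      weightedIntegral p v f ≤ D * ∫⁻ z in disc, ‖f z‖ₑ ^ p ∂weightMeasure ω := by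
  obtain ⟨K, hK, hKb⟩ := h
  have hpi := Real.pi_pos
  refine ⟨Real.toNNReal (Real.pi⁻¹ * K) + Real.toNNReal (Real.pi * K), fun f hf => ⟨?_, ?_⟩⟩
  · calc ∫⁻ z in disc, ‖f z‖ₑ ^ p ∂weightMeasure ω
        ≤ ∫⁻ z in disc, ‖f z‖ₑ ^ p ∂areaMeasure.withDensity
            (fun z => ENNReal.ofReal (K * v ‖z‖)) := by
          -- Comparing the measures rather than the integrands avoids any measurability of the
          -- profile `ω`; only `v` is known to be Borel.
          refine lintegral_mono' (Measure.restrict_mono_measure (withDensity_mono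
            (ae_areaMeasure_of_forall fun z hz => ?_)) _) le_rfl
          exact ENNReal.ofReal_le_ofReal (hKb _ (norm_mem_Ico hz)).1
      _ = ENNReal.ofReal (Real.pi⁻¹ * K) * weightedIntegral p v f :=
          hv.lintegral_withDensity hf p hK.le
      _ ≤ _ := by
          gcongr
          rw [ENNReal.coe_add]
          exact le_self_add
  · have h1 : ENNReal.ofReal (Real.pi⁻¹ * K⁻¹) * weightedIntegral p v f ≤
        ∫⁻ z in disc, ‖f z‖ₑ ^ p ∂weightMeasure ω := by
      rw [← hv.lintegral_withDensity hf p (inv_pos.2 hK).le]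
      refine lintegral_mono' (Measure.restrict_mono_measure (withDensity_mono
        (ae_areaMeasure_of_forall fun z hz => ?_)) _) le_rfl
      refine ENNReal.ofReal_le_ofReal ?_
      rw [inv_mul_le_iff₀ hK]
      exact (hKb _ (norm_mem_Ico hz)).2
    calc weightedIntegral p v f
        = ENNReal.ofReal (Real.pi * K) *
          (ENNReal.ofReal (Real.pi⁻¹ * K⁻¹) * weightedIntegral p v f) := by
          rw [← mul_assoc, ← ENNReal.ofReal_mul (by positivity),
            show Real.pi * K * (Real.pi⁻¹ * K⁻¹) = 1 by field_simp, ENNReal.ofReal_one, one_mul]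
      _ ≤ _ := by
          gcongr
          rw [ENNReal.coe_add]
          exact le_add_self

/-- An analytic function with vanishing weighted integral vanishes. -/
theorem PowerType.eq_zero_of_weightedIntegral {v : ℝ → ℝ} {a b p : ℝ} (h : PowerType v a b)
    (ha : 0 ≤ a) (hb : 0 ≤ b) (hp : 0 < p) {f : ℂ → ℂ} (hf : DifferentiableOn ℂ f disc)
    (h0 : weightedIntegral p v f = 0) {z : ℂ} (hz : z ∈ disc) : f z = 0 := by
  obtain ⟨C, hC⟩ := h.enorm_rpow_mul_cellWeight_le ha hb hp
  have hz1 : 0 ≤ (1 - ‖z‖) / 20 := by linarith [mem_disc.1 hz]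
  have h1 := hC f hf z hz z (mem_closedBall_self hz1)
  have h2 : ∫⁻ w in closedBall z ((1 - ‖z‖) / 10), ‖f w‖ₑ ^ p * ENNReal.ofReal (v ‖w‖) = 0 :=
    le_antisymm ((lintegral_mono_set (closedBall_subset_disc hz)).trans h0.le) zero_le
  rw [h2, mul_zero, nonpos_iff_eq_zero, mul_eq_zero] at h1
  rcases h1 with h1 | h1
  · simpa [hp, hp.not_gt] using h1
  · exact absurd h1 (h.cellWeight_ne_zero hz)

variable {n : ℕ} {p q : Fin n → ℝ} {v ω : Fin n → ℝ → ℝ} {a b : Fin n → ℝ}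

/-- The multilinear Carleson inequality in terms of the supremum `multiNorm`. -/
theorem multiBound_multiNorm (hv : ∀ i, PowerType (v i) (a i) (b i)) (ha : ∀ i, 0 ≤ a i)
    (hb : ∀ i, 0 ≤ b i) (hω : ∀ i, WeightEquiv (ω i) (v i)) (hp : ∀ i, 0 < p i)
    (hq : ∀ i, 0 < q i) :
    ∃ D : ℝ≥0, ∀ μ : Measure ℂ, MultiBound p q v μ (D * multiNorm p q ω μ) ∧
      ∀ M : ℝ≥0∞, MultiBound p q v μ M → multiNorm p q ω μ ≤ D * M := by
  have hpq : ∀ i, 0 ≤ q i / p i := fun i => (div_pos (hq i) (hp i)).le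
  choose D hD using fun i => (hω i).exists_integral_bound (hv i) (p i)
  refine ⟨∏ i, D i ^ (q i / p i), fun μ => ⟨fun f hf hfin => ?_, fun M hM => ?_⟩⟩
  -- If one integral is zero, the quotient in `multiNorm` cannot be cleared of its denominator; but
  -- then that `f i` vanishes on the disc and the left side is zero.
  · by_cases hzero : ∃ i, weightedIntegral (p i) (v i) (f i) = 0
    · obtain ⟨i, hi⟩ := hzero
      refine le_of_eq_of_le ?_ zero_le
      rw [← lintegral_zero (μ := μ.restrict disc)]
      refine setLIntegral_congr_fun measurableSet_disc fun z hz => ?_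
      refine Finset.prod_eq_zero (Finset.mem_univ i) ?_
      rw [(hv i).eq_zero_of_weightedIntegral (ha i) (hb i) (hp i) (hf i) hi hz]
      simp [hq i]
    · push Not at hzero
      have hJt : ∀ i, ∫⁻ z in disc, ‖f i z‖ₑ ^ p i ∂weightMeasure (ω i) ≠ ∞ := fun i =>
        ((hD i (f i) (hf i)).1.trans_lt (ENNReal.mul_lt_top (by simp) (hfin i))).ne
      have hJ0 : ∀ i, ∫⁻ z in disc, ‖f i z‖ₑ ^ p i ∂weightMeasure (ω i) ≠ 0 := fun i h0 => by
        have := (hD i (f i) (hf i)).2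
        rw [h0, mul_zero] at this
        exact hzero i (nonpos_iff_eq_zero.1 this)
      have hmem : ∀ i, f i ∈ bergmanSpace (p i) (ω i) := by
        refine fun i => ⟨hf i, ?_⟩
        rw [bergmanNorm, lpNorm_eq (hp i)]
        exact ENNReal.rpow_lt_top_of_nonneg (inv_nonneg.2 (hp i).le) (hJt i)
      have hle : (∫⁻ z in disc, ∏ i, ‖f i z‖ₑ ^ q i ∂μ) /
          ∏ i, bergmanNorm (p i) (ω i) (f i) ^ q i ≤ multiNorm p q ω μ :=
        le_iSup₂_of_le f hmem le_rfl
      simp only [bergmanNorm, lpNorm_rpow (hp _)] at hle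
      rw [ENNReal.div_le_iff
        (Finset.prod_ne_zero_iff.2 fun i _ => by simp [hJ0 i, hJt i])
        (ENNReal.prod_ne_top fun i _ => ENNReal.rpow_ne_top_of_nonneg (hpq i) (hJt i))] at hle
      refine hle.trans ?_
      rw [mul_comm ((∏ i, D i ^ (q i / p i) : ℝ≥0) : ℝ≥0∞), mul_assoc]
      gcongr
      push_cast
      rw [← Finset.prod_mul_distrib]
      refine Finset.prod_le_prod' fun i _ => ?_
      rw [ENNReal.coe_rpow_of_nonneg _ (hpq i), ← ENNReal.mul_rpow_of_nonneg _ _ (hpq i)]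
      exact ENNReal.rpow_le_rpow (hD i (f i) (hf i)).1 (hpq i)
  · refine iSup₂_le fun f hf => ENNReal.div_le_of_le_mul ?_
    simp only [bergmanNorm, lpNorm_rpow (hp _)]
    have hJt : ∀ i, ∫⁻ z in disc, ‖f i z‖ₑ ^ p i ∂weightMeasure (ω i) < ∞ := fun i => by
      have := (hf i).2
      rw [bergmanNorm, lpNorm_eq (hp i)] at this
      exact (ENNReal.rpow_lt_top_iff_of_pos (inv_pos.2 (hp i))).1 this
    refine (hM f (fun i => (hf i).1) fun i => ((hD i (f i) (hf i).1).2.trans_lt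
      (ENNReal.mul_lt_top (by simp) (hJt i)))).trans ?_
    rw [mul_comm ((∏ i, D i ^ (q i / p i) : ℝ≥0) : ℝ≥0∞), mul_assoc]
    gcongr
    push_cast
    rw [← Finset.prod_mul_distrib]
    refine Finset.prod_le_prod' fun i _ => ?_
    rw [ENNReal.coe_rpow_of_nonneg _ (hpq i), ← ENNReal.mul_rpow_of_nonneg _ _ (hpq i)]
    exact ENNReal.rpow_le_rpow (hD i (f i) (hf i).1).2 (hpq i)

/-- With target exponent `1` the norm in `L^1_μ` is the integral itself, so the operator norm is the
one-function case of the multilinear supremum. -/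
theorem idNorm_one_eq_multiNorm {P : ℝ} (ω : ℝ → ℝ) (μ : Measure ℂ) :
    idNorm P ω 1 μ = multiNorm (n := 1) (fun _ => P) (fun _ => 1) (fun _ => ω) μ := by
  have e : ∀ f : ℂ → ℂ, lpNorm 1 μ f = ∫⁻ z in disc, ‖f z‖ₑ ∂μ := by
    intro f
    rw [lpNorm_eq one_pos]
    simp
  refine le_antisymm (iSup₂_le fun f hf => ?_) (iSup₂_le fun f hf => ?_)
  · refine le_iSup₂_of_le (fun _ => f) (fun _ => hf) ?_
    simp [e]
  · refine le_iSup₂_of_le (f 0) (hf 0) ?_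
    simp [e]

/-- Carleson measures for `A^1_ω` in terms of the Carleson inequality for equivalent weights. -/
theorem isCarleson_iff_multiBound {w V : ℝ → ℝ} {α β l : ℝ} (hV : PowerType V α β)
    (hw : WeightEquiv w V) (hl : 0 < l) (μ : Measure ℂ) :
    IsCarleson l 1 w μ ↔
      ∃ M : ℝ≥0, MultiBound (ι := Fin 1) (fun _ => 1) (fun _ => l) (fun _ => V) μ M := by
  obtain ⟨D, hD⟩ := hw.exists_integral_bound hV 1
  have e : ∀ f : ℂ → ℂ, bergmanNorm 1 w f = ∫⁻ z in disc, ‖f z‖ₑ ^ (1 : ℝ) ∂weightMeasure w := by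
    intro f
    rw [bergmanNorm, lpNorm_eq one_pos, inv_one, ENNReal.rpow_one]
  constructor
  · rintro ⟨C, hC⟩
    refine ⟨(C * D) ^ l, fun f hf hfin => ?_⟩
    have hJ := (hD (f 0) (hf 0)).1
    have h1 := hC (f 0) ⟨hf 0, by
      rw [e]
      exact hJ.trans_lt (ENNReal.mul_lt_top (by simp) (hfin 0))⟩
    have h2 := ENNReal.rpow_le_rpow (h1.trans (mul_le_mul_right ((e _).le.trans hJ) _)) hl.le
    rw [lpNorm_rpow hl, div_self hl.ne', ENNReal.rpow_one, ← mul_assoc,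
      ENNReal.mul_rpow_of_nonneg _ _ hl.le] at h2
    simpa [ENNReal.coe_rpow_of_nonneg _ hl.le] using h2
  · rintro ⟨M, hM⟩
    refine ⟨M ^ l⁻¹ * D, fun f hf => ?_⟩
    have hJ := (hD f hf.1).2
    have hfin : weightedIntegral 1 V f < ∞ := hJ.trans_lt (ENNReal.mul_lt_top (by simp) (by
      rw [← e]
      exact hf.2))
    have h1 := hM (fun _ => f) (fun _ => hf.1) (fun _ => hfin)
    simp only [Finset.univ_unique, Finset.prod_singleton, div_one] at h1
    rw [lpNorm_eq hl, e]
    refine (ENNReal.rpow_le_rpow h1 (inv_nonneg.2 hl.le)).trans ?_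
    rw [ENNReal.mul_rpow_of_nonneg _ _ (inv_nonneg.2 hl.le), ← ENNReal.rpow_mul,
      mul_inv_cancel₀ hl.ne', ENNReal.rpow_one, ENNReal.coe_mul,
      ENNReal.coe_rpow_of_nonneg _ (inv_nonneg.2 hl.le), mul_assoc]
    gcongr

end

/-! ### Reduction to the geometric mean of the weights, and conclusion -/

section

variable {n : ℕ} {p q : Fin n → ℝ} {v : Fin n → ℝ → ℝ} {a b : Fin n → ℝ}

/-- The product of the cell weights is the cell weight of the geometric mean. -/
theorem prod_cellWeight_rpow (hv : ∀ i, PowerType (v i) (a i) (b i)) {l : ℝ} (hl : 0 < l)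
    (hlpq : ∑ i, q i / p i = l) {α : ℂ} (hα : α ∈ disc) :
    ∏ i, cellWeight (v i) α ^ (q i / p i) =
      cellWeight (fun r => ∏ i, v i r ^ (q i / p i / l)) α ^ l := by
  have h1 : 0 < 1 - ‖α‖ := by linarith [mem_disc.1 hα]
  have h2 : ∀ i, 0 < v i ‖α‖ := fun i => (hv i).pos _ (norm_mem_Ico hα)
  have h3 : 0 < ∏ i, v i ‖α‖ ^ (q i / p i / l) :=
    Finset.prod_pos fun i _ => Real.rpow_pos_of_pos (h2 i) _
  simp only [cellWeight]
  rw [ENNReal.ofReal_rpow_of_pos (by positivity)]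
  have e : ∀ i, ENNReal.ofReal ((1 - ‖α‖) ^ 2 * v i ‖α‖) ^ (q i / p i) =
      ENNReal.ofReal (((1 - ‖α‖) ^ 2 * v i ‖α‖) ^ (q i / p i)) := fun i =>
    ENNReal.ofReal_rpow_of_pos (mul_pos (by positivity) (h2 i))
  simp only [e]
  rw [← ENNReal.ofReal_prod_of_nonneg fun i _ =>
    Real.rpow_nonneg (mul_pos (by positivity) (h2 i)).le _]
  congr 1
  rw [Real.mul_rpow (by positivity) h3.le, ← Real.finsetProd_rpow _ _ fun i _ =>
    (Real.rpow_pos_of_pos (h2 i) _).le]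
  -- The area factors match because the exponents `q i / p i` add up to `l`.
  have e2 : ((1 - ‖α‖) ^ 2) ^ l = ∏ i, ((1 - ‖α‖) ^ 2) ^ (q i / p i) := by
    rw [← hlpq, Real.rpow_sum_of_pos (by positivity)]
  rw [e2, ← Finset.prod_mul_distrib]
  refine Finset.prod_congr rfl fun i _ => ?_
  rw [Real.mul_rpow (by positivity) (h2 i).le, ← Real.rpow_mul (h2 i).le,
    div_mul_cancel₀ _ hl.ne']

theorem SeqBound.congr {u : Set ℂ} {l : ℝ} {W W' : ℂ → ℝ≥0∞} {μ : Measure ℂ} {N : ℝ≥0∞}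
    (h : SeqBound u l W μ N) (hW : ∀ α ∈ u, W α = W' α) : SeqBound u l W' μ N := by
  intro s hs y
  refine le_of_eq_of_le (Finset.sum_congr rfl fun α hα => ?_) (h s hs y)
  rw [hW α (hs hα)]

/-- The multilinear Carleson inequality is equivalent to the linear one for the geometric mean of
the weights, for any pair of exponents with quotient `∑ q_i / p_i`. -/
theorem exists_multiBound_iff_single (hn : 1 ≤ n) (hv : ∀ i, PowerType (v i) (a i) (b i))
    (ha : ∀ i, 0 < a i) (hb : ∀ i, 0 ≤ b i) (hp : ∀ i, 0 < p i) (hq : ∀ i, 0 < q i) {l P Q : ℝ}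
    (hl : ∑ i, q i / p i = l) (hP : 0 < P) (hQ : 0 < Q) (hPQ : Q / P = l) :
    ∃ C : ℝ≥0, ∀ (μ : Measure ℂ) (M : ℝ≥0∞),
      (MultiBound p q v μ M → MultiBound (ι := Fin 1) (fun _ => P) (fun _ => Q)
        (fun _ r => ∏ i, v i r ^ (q i / p i / l)) μ (C * M)) ∧
      (MultiBound (ι := Fin 1) (fun _ => P) (fun _ => Q)
        (fun _ r => ∏ i, v i r ^ (q i / p i / l)) μ M → MultiBound p q v μ (C * M)) := by
  have : Nonempty (Fin n) := ⟨⟨0, hn⟩⟩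
  have hpq : ∀ i, 0 < q i / p i := fun i => div_pos (hq i) (hp i)
  have hl0 : 0 < l := hPQ ▸ div_pos hQ hP
  have hθ0 : ∀ i, 0 < q i / p i / l := fun i => div_pos (hpq i) hl0
  have hθ1 : ∑ i, q i / p i / l = 1 := by rw [← Finset.sum_div, hl, div_self hl0.ne']
  have hV := PowerType.prod_rpow hv hθ1 fun i => (hθ0 i).le
  have haV : 0 < ∑ i, q i / p i / l * a i :=
    Finset.sum_pos (fun i _ => mul_pos (hθ0 i) (ha i)) Finset.univ_nonempty
  have hbV : 0 ≤ ∑ i, q i / p i / l * b i :=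
    Finset.sum_nonneg fun i _ => mul_nonneg (hθ0 i).le (hb i)
  obtain ⟨u, hu⟩ := exists_isLattice
  obtain ⟨C₁, h₁⟩ := MultiBound.seqBound hv ha hp hq hu
  obtain ⟨C₂, h₂⟩ := SeqBound.multiBound hv ha hb hp hq hu
  obtain ⟨C₃, h₃⟩ := MultiBound.seqBound (ι := Fin 1) (fun _ => hV) (fun _ => haV) (fun _ => hP)
    (fun _ => hQ) hu
  obtain ⟨C₄, h₄⟩ := SeqBound.multiBound (ι := Fin 1) (fun _ => hV) (fun _ => haV) (fun _ => hbV)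
    (fun _ => hP) (fun _ => hQ) hu
  simp only [Finset.univ_unique, Finset.sum_singleton, Finset.prod_singleton, hPQ] at h₃ h₄
  rw [hl] at h₁ h₂
  have hW : ∀ α ∈ u, ∏ i, cellWeight (v i) α ^ (q i / p i) =
      cellWeight (fun r => ∏ i, v i r ^ (q i / p i / l)) α ^ l := fun α hα =>
    prod_cellWeight_rpow hv hl0 hl (hu.subset_disc hα)
  have mono : ∀ {m : ℕ} {p q : Fin m → ℝ} {v : Fin m → ℝ → ℝ} {μ : Measure ℂ} {M M' : ℝ≥0∞},
      MultiBound p q v μ M → M ≤ M' → MultiBound p q v μ M' := fun h hle f hf hfin =>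
    (h f hf hfin).trans (mul_le_mul_left hle _)
  -- Each direction passes through the discrete inequality over the common lattice `u`; the sum of
  -- the two composite constants serves both.
  refine ⟨C₄ * C₁ + C₂ * C₃, fun μ M => ⟨fun hM => ?_, fun hM => ?_⟩⟩
  · refine mono (h₄ μ _ ((h₁ μ M hM).congr hW)) ?_
    rw [← mul_assoc, ← ENNReal.coe_mul]
    gcongr
    exact le_self_add
  · refine mono (h₂ μ _ ((h₃ μ M hM).congr fun α hα => (hW α hα).symm)) ?_
    rw [← mul_assoc, ← ENNReal.coe_mul]
    gcongr
    exact le_add_self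

end

end WeightedBergman

end

open WeightedBergman

theorem theorem2 {n : ℕ} (hn : 1 ≤ n) (p q : Fin n → ℝ) (hp : ∀ i, 0 < p i) (hq : ∀ i, 0 < q i)
    (ω : Fin n → ℝ → ℝ) (hω : ∀ i, WeightedBergman.IsRegularWeight (ω i)) :
    (∀ μ : MeasureTheory.Measure ℂ,
      WeightedBergman.IsCarleson (WeightedBergman.totalExponent p q) 1
          (WeightedBergman.productWeight p q ω) μ ↔
        WeightedBergman.multiNorm p q ω μ < ⊤) ∧
    ∃ C : NNReal, 0 < C ∧ ∀ μ : MeasureTheory.Measure ℂ,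
      WeightedBergman.multiNorm p q ω μ ≤
          C * WeightedBergman.idNorm (1 / WeightedBergman.totalExponent p q)
            (WeightedBergman.productWeight p q ω) 1 μ ∧
        WeightedBergman.idNorm (1 / WeightedBergman.totalExponent p q)
            (WeightedBergman.productWeight p q ω) 1 μ ≤
          C * WeightedBergman.multiNorm p q ω μ := by
  have : Nonempty (Fin n) := ⟨⟨0, hn⟩⟩
  choose v a b hv ha hb hωv using fun i => (hω i).exists_powerType
  have hpq : ∀ i, 0 < q i / p i := fun i => div_pos (hq i) (hp i)
  set l := totalExponent p q with hl
  have hl' : ∑ i, q i / p i = l := rfl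
  have hl0 : 0 < l := Finset.sum_pos (fun i _ => hpq i) Finset.univ_nonempty
  have hθ0 : ∀ i, 0 ≤ q i / p i / l := fun i => (div_pos (hpq i) hl0).le
  have hθ1 : ∑ i, q i / p i / l = 1 := by rw [← Finset.sum_div, hl', div_self hl0.ne']
  have hV := PowerType.prod_rpow hv hθ1 hθ0
  have haV : 0 ≤ ∑ i, q i / p i / l * a i :=
    Finset.sum_nonneg fun i _ => mul_nonneg (hθ0 i) (ha i).le
  have hbV : 0 ≤ ∑ i, q i / p i / l * b i :=
    Finset.sum_nonneg fun i _ => mul_nonneg (hθ0 i) (hb i)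
  have hwV : WeightEquiv (productWeight p q ω) (fun r => ∏ i, v i r ^ (q i / p i / l)) := by
    have := WeightEquiv.prod_rpow hωv (fun i => (hω i).pos) (fun i => (hv i).pos) hθ0
    have e : productWeight p q ω = fun r => ∏ i, ω i r ^ (q i / p i / l) := by
      ext r
      refine Finset.prod_congr rfl fun i _ => ?_
      rw [← hl, div_div, mul_comm l]
    rwa [e]
  obtain ⟨D, hD⟩ := multiBound_multiNorm hv (fun i => (ha i).le) hb hωv hp hq
  constructor
  · intro μ
    -- The single-weight exponents are `P = 1` and `Q = λ`, matching `A^1_ω → L^λ_μ`.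
    obtain ⟨C, hC⟩ := exists_multiBound_iff_single hn hv ha hb hp hq hl' one_pos hl0 (div_one l)
    rw [isCarleson_iff_multiBound hV hwV hl0]
    constructor
    · rintro ⟨M, hM⟩
      exact ((hD μ).2 _ ((hC μ M).2 hM)).trans_lt
        (ENNReal.mul_lt_top (by simp) (ENNReal.mul_lt_top (by simp) (by simp)))
    · intro hM
      have h1 := (hC μ _).1 (hD μ).1
      refine ⟨C * (D * (multiNorm p q ω μ).toNNReal), ?_⟩
      rwa [ENNReal.coe_mul, ENNReal.coe_mul, ENNReal.coe_toNNReal hM.ne]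
  -- Now `P = 1 / λ` and `Q = 1`, with the same quotient, matching `A^{1/λ}_ω → L^1_μ`.
  · obtain ⟨C, hC⟩ := exists_multiBound_iff_single hn hv ha hb hp hq hl'
      (one_div_pos.2 hl0) one_pos (by rw [one_div_one_div])
    obtain ⟨E, hE⟩ := multiBound_multiNorm (n := 1) (fun _ => hV) (fun _ => haV) (fun _ => hbV)
      (fun _ => hwV) (fun _ => one_div_pos.2 hl0) (fun _ => one_pos)
    -- The summand `1` only makes the constant positive.
    refine ⟨D * C * E + 1, by positivity, fun μ => ?_⟩
    rw [idNorm_one_eq_multiNorm]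
    have hle : ((D * C * E : ℝ≥0) : ℝ≥0∞) ≤ ((D * C * E + 1 : ℝ≥0) : ℝ≥0∞) := by
      exact_mod_cast le_self_add
    constructor
    · refine ((hD μ).2 _ ((hC μ _).2 (hE μ).1)).trans (le_trans (le_of_eq ?_)
        (mul_le_mul_left hle _))
      push_cast
      ring
    · refine ((hE μ).2 _ ((hC μ _).1 (hD μ).1)).trans (le_trans (le_of_eq ?_)
        (mul_le_mul_left hle _))
      push_cast
      ring
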